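/- For a real number $\theta$ let $$M_\theta=\Big\{\lfloor x\rfloor,\ \lfloor x\rfloor+1 \;:\; x=\sum_{j=0}^{n}c_j\theta^j,\ n\in\mathbb N_0,\ c_0,\dots,c_n\in\{0,1\}\Big\}\subset\mathbb Z .$$ **Theorem.** There exists a relatively dense set $\Lambda\subset\mathbb Z$ such that $\|\delta_\Lambda-\delta_{\mathbb Z}\|_u=0$ and $\Lambda$ is not a regular model set in $\mathbb Z$; moreover $\delta_\Lambda$ is Weyl almost periodic but not generalized almost periodic. In fact, for every transcendental real number $\theta>3$ the set $\Lambda=\mathbb Z\setminus M_\theta$ has all these properties. **Definitions** (for a $\sigma$-compact locally compact abelian group $G$ with Haar measure $|\cdot|$; here $G=\mathbb Z$ with counting measure). A measure is a linear functional on $C_c(G)$ that is continuous in the inductive topology. The Dirac comb of a locally finite set $\Lambda$ is $\delta_\Lambda=\sum_{x\in\Lambda}\delta_x$. The set $\Lambda$ is relatively dense if $\Lambda+K=G$ for some compact $K$. A van Hove sequence is a sequence of compact sets $A_n$ with $|A_n|>0$ and $|\partial^K A_n|/|A_n|\to0$ for every compact $K$, where $\partial^K A=((A+K)\cap(G\setminus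 A^\circ))\cup((-K+\overline{G\setminus A})\cap A)$. * Uniform upper density: $\|\mu\|_u=\limsup_n\sup_{x\in G}|\mu|(x+A_n)/|A_n|$, where $|\mu|$ is the total variation of $\mu$ and $(A_n)$ is any van Hove sequence. * Regular model set: $\Lambda=\{x\in G:\exists\, y\in W,\ (x,y)\in\mathcal L\}$, where $H$ is a locally compact abelian group, $\mathcal L\subset G\times H$ is a discrete co-compact subgroup whose projection to $G$ is one-to-one and whose projection to $H$ has dense range, and $W\subset H$ has non-empty interior, compact closure, and boundary of Haar measure $0$. * $\mu$ is translation bounded if $\varphi*\mu$ is bounded for all $\varphi\in C_c(G)$, where $(\varphi*\mu)(x)=\int\varphi(x-t)\,d\mu(t)$. * Weyl almost periodic: $\mu$ is translation bounded, and for all $\varphi\in C_c(G)$ and $\varepsilon>0$ there is a trigonometric polynomial $P$ (a finite linear combination of continuous characters) such that $\limsup_n\sup_{x}|A_n|^{-1}\int_{A_n}|(\varphi*\mu-P)(x-t)|\,dt<\varepsilon$, where $(A_n)$ is any van Hove sequence. * A bounded uniformly continuous function $f$ is Bohr almost periodic if for every $\varepsilon>0$ the set $\{x:\|f-f(\cdot-x)\|_\infty<\varepsilon\}$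 is relatively dense. A translation bounded measure $\mu$ is strongly almost periodic if $\varphi*\mu$ is Bohr almost periodic for all $\varphi\in C_c(G)$. The mean $M(f)$ of a Bohr almost periodic function $f$ is the integral of its continuous extension to the Bohr compactification of $G$ against normalised Haar measure, and the mean $M(\mu)$ of a strongly almost periodic measure $\mu$ is determined by $M(\varphi*\mu)=M(\mu)\int_G\varphi(t)\,dt$ for all $\varphi\in C_c(G)$. * Generalized almost periodic: a real translation bounded measure $\varrho$ is generalized almost periodic if for every $\varepsilon>0$ there are strongly almost periodic measures $\mu\le\varrho\le\nu$ with $M(\nu-\mu)<\varepsilon$; a complex translation bounded measure is if its real and imaginary parts are. -/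

import Mathlib

open MeasureTheory Filter Topology
open scoped CompactlySupported Pointwise ENNReal

noncomputable section

namespace AlmostPeriodic

/-! ### Measures as continuous linear functionals on `C_c(G, ℂ)` -/

section Measures

variable {G : Type*} [TopologicalSpace G]

/-- A linear functional on `C_c(G)` is continuous for the inductive topology if and only if, for
each compact `K`, it is bounded in the supremum norm on the functions vanishing outside `K`. -/
def IsInductivelyContinuous (μ : C_c(G, ℂ) →ₗ[ℂ] ℂ) : Prop :=
  ∀ K : Set G, IsCompact K → ∃ C : ℝ, 0 ≤ C ∧
    ∀ (φ : C_c(G, ℂ)) (B : ℝ), (∀ x, x ∉ K → φ x = 0) → 0 ≤ B → (∀ x, ‖φ x‖ ≤ B) → ‖μ φ‖ ≤ C * B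

variable (G) in
/-- The complex vector space of (complex Radon) measures on `G`. -/
def radonMeasures : Submodule ℂ (C_c(G, ℂ) →ₗ[ℂ] ℂ) where
  carrier := {μ | IsInductivelyContinuous μ}
  zero_mem' := fun _ _ => ⟨0, le_rfl, fun φ B _ _ _ => by simp⟩
  add_mem' := by
    intro μ ν hμ hν K hK
    obtain ⟨C, hC, h⟩ := hμ K hK
    obtain ⟨D, hD, h'⟩ := hν K hK
    refine ⟨C + D, by positivity, fun φ B hφ hB hb => ?_⟩
    have h1 := h φ B hφ hB hb
    have h2 := h' φ B hφ hB hb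
    calc ‖(μ + ν) φ‖ ≤ ‖μ φ‖ + ‖ν φ‖ := norm_add_le _ _
      _ ≤ (C + D) * B := by linarith
  smul_mem' := by
    intro c μ hμ K hK
    obtain ⟨C, hC, h⟩ := hμ K hK
    refine ⟨‖c‖ * C, by positivity, fun φ B hφ hB hb => ?_⟩
    have h1 := mul_le_mul_of_nonneg_left (h φ B hφ hB hb) (norm_nonneg c)
    calc ‖(c • μ) φ‖ = ‖c‖ * ‖μ φ‖ := norm_mul _ _
      _ ≤ ‖c‖ * C * B := by linarith

variable (G) in
/-- The type of (complex Radon) measures on `G`. -/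
abbrev RadonMeasure : Type _ := ↥(radonMeasures G)

/-- The value `μ(φ) = ∫ φ dμ`. -/
def RadonMeasure.eval (μ : RadonMeasure G) (φ : C_c(G, ℂ)) : ℂ := μ.1 φ

/-- The conjugate measure, `φ ↦ conj (μ (conj φ))`. -/
def RadonMeasure.conj (μ : RadonMeasure G) : RadonMeasure G :=
  ⟨{ toFun := fun φ => star (μ.1 (star φ))
     map_add' := fun φ ψ => by simp
     map_smul' := fun c φ => by simp [star_smul] }, by
    intro K hK
    obtain ⟨C, hC, h⟩ := μ.2 K hK
    refine ⟨C, hC, fun φ B hφ hB hb => ?_⟩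
    have := h (star φ) B (fun x hx => by simp [hφ x hx]) hB (fun x => by simpa using hb x)
    simpa using this⟩

/-- The real part of a measure. -/
def RadonMeasure.re (μ : RadonMeasure G) : RadonMeasure G := (1 / 2 : ℂ) • (μ + μ.conj)

/-- The imaginary part of a measure. -/
def RadonMeasure.im (μ : RadonMeasure G) : RadonMeasure G :=
  (1 / (2 * Complex.I) : ℂ) • (μ - μ.conj)

/-- Real measures: they take real values on real-valued functions. -/
def RadonMeasure.IsReal (μ : RadonMeasure G) : Prop :=
  ∀ φ : C_c(G, ℂ), (∀ x, (φ x).im = 0) → (μ.eval φ).im = 0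

/-- Positive measures: they take nonnegative real values on nonnegative functions. -/
def RadonMeasure.IsPositive (μ : RadonMeasure G) : Prop :=
  ∀ φ : C_c(G, ℂ), (∀ x, 0 ≤ (φ x).re ∧ (φ x).im = 0) → 0 ≤ (μ.eval φ).re ∧ (μ.eval φ).im = 0

/-- The total variation `|μ|` of a compact set `K`:
`|μ|(φ) = sup {|μ(ψ)| : |ψ| ≤ φ}` for nonnegative `φ ∈ C_c(G)`, and `|μ|(K)` is the infimum of
`|μ|(φ)` over all `φ ∈ C_c(G)` with `1_K ≤ φ`. -/
def RadonMeasure.variation (μ : RadonMeasure G) (K : Set G) : ℝ≥0∞ :=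
  ⨅ φ : {φ : C_c(G, ℝ) // (∀ x, 0 ≤ φ x) ∧ ∀ x ∈ K, 1 ≤ φ x},
    ⨆ ψ : {ψ : C_c(G, ℂ) // ∀ x, ‖ψ x‖ ≤ φ.1 x}, ‖μ.eval ψ.1‖ₑ

/-- Sets meeting every compact set in only finitely many points. -/
def IsLocallyFiniteSet (Λ : Set G) : Prop := ∀ K : Set G, IsCompact K → (K ∩ Λ).Finite

theorem IsLocallyFiniteSet.of_discrete [DiscreteTopology G] (Λ : Set G) : IsLocallyFiniteSet Λ :=
  fun _ hK => (isCompact_iff_finite.1 hK).subset Set.inter_subset_left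

theorem IsLocallyFiniteSet.finite_support {Λ : Set G} (h : IsLocallyFiniteSet Λ)
    (φ : C_c(G, ℂ)) : (Function.support fun x : Λ => φ x).Finite := by
  refine Set.Finite.of_finite_image (f := Subtype.val) ?_ Subtype.val_injective.injOn
  refine (h _ φ.hasCompactSupport).subset ?_
  rintro _ ⟨x, hx, rfl⟩
  exact ⟨subset_tsupport _ hx, x.2⟩

/-- The Dirac comb `δ_Λ = ∑_{x ∈ Λ} δ_x`; the sum `∑_{x ∈ Λ} φ x` has only finitely many nonzero
terms for `φ ∈ C_c(G)`. -/
def diracComb (Λ : Set G) (h : IsLocallyFiniteSet Λ) : RadonMeasure G :=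
  ⟨{ toFun := fun φ => ∑ᶠ x : Λ, φ x
     map_add' := fun φ ψ => by
       simpa using finsum_add_distrib (h.finite_support φ) (h.finite_support ψ)
     map_smul' := fun c φ => by
       simpa using (smul_finsum' c (h.finite_support φ)).symm }, by
    intro K hK
    refine ⟨((h K hK).toFinset.card : ℝ), by positivity, fun φ B hφ hB hb => ?_⟩
    have hfin : (Subtype.val ⁻¹' K : Set Λ).Finite := by
      refine Set.Finite.of_finite_image (f := Subtype.val) ?_ Subtype.val_injective.injOn
      refine (h K hK).subset ?_
      rintro _ ⟨x, hx, rfl⟩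
      exact ⟨hx, x.2⟩
    have hsub : (Function.support fun x : Λ => φ x) ⊆ (hfin.toFinset : Set Λ) := by
      intro x hx
      simp only [Set.Finite.coe_toFinset, Set.mem_preimage]
      by_contra hxK
      exact hx (hφ _ hxK)
    have hcard : hfin.toFinset.card ≤ (h K hK).toFinset.card := by
      refine Finset.card_le_card_of_injOn Subtype.val ?_ Subtype.val_injective.injOn
      intro x hx
      have hx' : (x : G) ∈ K := by simpa using hx
      simp [hx']
    change ‖∑ᶠ x : Λ, φ x‖ ≤ _
    rw [finsum_eq_sum_of_support_subset _ hsub]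
    calc ‖∑ x ∈ hfin.toFinset, φ x‖ ≤ ∑ x ∈ hfin.toFinset, ‖φ x‖ := norm_sum_le _ _
      _ ≤ ∑ x ∈ hfin.toFinset, B := Finset.sum_le_sum fun x _ => hb x
      _ = (hfin.toFinset.card : ℝ) * B := by simp
      _ ≤ _ := by gcongr⟩

end Measures

section Groups

variable {G : Type*} [AddCommGroup G] [TopologicalSpace G]

/-- `Λ` is relatively dense if `Λ + K = G` for some compact `K`. -/
def IsRelativelyDense (Λ : Set G) : Prop := ∃ K : Set G, IsCompact K ∧ Λ + K = Set.univ

/-! ### Convolution and translation boundedness -/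

/-- The function `t ↦ φ (x - t)`. -/
def reflectTranslate [IsTopologicalAddGroup G] (φ : C_c(G, ℂ)) (x : G) : C_c(G, ℂ) where
  toFun := fun t => φ (x - t)
  continuous_toFun := φ.continuous.comp (continuous_const.sub continuous_id)
  hasCompactSupport' := φ.hasCompactSupport.comp_homeomorph (Homeomorph.subLeft x)

/-- The convolution `(φ * μ)(x) = ∫ φ (x - t) dμ(t)`. -/
def conv [IsTopologicalAddGroup G] (φ : C_c(G, ℂ)) (μ : RadonMeasure G) (x : G) : ℂ :=
  μ.eval (reflectTranslate φ x)

/-- `μ` is translation bounded if all the functions `φ * μ` are bounded. -/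
def IsTranslationBounded [IsTopologicalAddGroup G] (μ : RadonMeasure G) : Prop :=
  ∀ φ : C_c(G, ℂ), ∃ C : ℝ, ∀ x, ‖conv φ μ x‖ ≤ C

/-! ### Bohr almost periodic functions and strongly almost periodic measures -/

/-- Bounded and uniformly continuous functions. -/
def IsBoundedUniformlyContinuous (f : G → ℂ) : Prop :=
  (∃ C : ℝ, ∀ x, ‖f x‖ ≤ C) ∧
    ∀ ε : ℝ, 0 < ε → ∃ U ∈ 𝓝 (0 : G), ∀ u ∈ U, ∀ x, ‖f (x + u) - f x‖ < ε

/-- The set `{x : ‖f - τ_x f‖_∞ < ε}` of `ε`-almost periods of `f`. -/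
def almostPeriods (f : G → ℂ) (ε : ℝ) : Set G :=
  {x | ⨆ t, ‖f t - f (t - x)‖ₑ < ENNReal.ofReal ε}

/-- Bohr almost periodic functions. -/
def IsBohrAlmostPeriodic (f : G → ℂ) : Prop :=
  IsBoundedUniformlyContinuous f ∧ ∀ ε : ℝ, 0 < ε → IsRelativelyDense (almostPeriods f ε)

/-- Strongly almost periodic measures. -/
def IsStronglyAlmostPeriodic [IsTopologicalAddGroup G] (μ : RadonMeasure G) : Prop :=
  IsTranslationBounded μ ∧ ∀ φ : C_c(G, ℂ), IsBohrAlmostPeriodic (conv φ μ)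

/-! ### The Bohr compactification and the mean -/

variable (G) in
/-- The continuous characters of `G`. -/
def ContinuousCharacter : Type _ := {χ : AddChar G Circle // Continuous χ}

variable (G) in
/-- The evaluation homomorphism of `G` into the power of the circle group indexed by the
continuous characters. (`G` is written additively, the circle multiplicatively.) -/
def bohrEval : Multiplicative G →* (ContinuousCharacter G → Circle) where
  toFun := fun x χ => χ.1 x.toAdd
  map_one' := by ext χ; simp
  map_mul' := fun x y => by ext χ; simp [AddChar.map_add_eq_mul]

variable (G) in
/-- The Bohr compactification of `G`: the closure of the image of `G` in the power of the circle
group indexed by the continuous characters. -/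
def BohrCompactification : Type _ := ↥((bohrEval G).range.topologicalClosure)

instance : CommGroup (BohrCompactification G) :=
  inferInstanceAs (CommGroup ↥((bohrEval G).range.topologicalClosure))

instance : TopologicalSpace (BohrCompactification G) :=
  inferInstanceAs (TopologicalSpace ↥((bohrEval G).range.topologicalClosure))

instance : IsTopologicalGroup (BohrCompactification G) :=
  inferInstanceAs (IsTopologicalGroup ↥((bohrEval G).range.topologicalClosure))

instance : T2Space (BohrCompactification G) :=
  inferInstanceAs (T2Space ↥((bohrEval G).range.topologicalClosure))

instance : CompactSpace (BohrCompactification G) :=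
  isCompact_iff_compactSpace.1 (Subgroup.isClosed_topologicalClosure (bohrEval G).range).isCompact

instance : MeasurableSpace (BohrCompactification G) := borel _

instance : BorelSpace (BohrCompactification G) := ⟨rfl⟩

/-- The canonical map of `G` into its Bohr compactification. -/
def toBohr (x : G) : BohrCompactification G :=
  ⟨bohrEval G (Multiplicative.ofAdd x), subset_closure ⟨_, rfl⟩⟩

/-- `c` is the mean of the function `f`: `f` extends (necessarily uniquely) to a continuous function
on the Bohr compactification, whose integral for the normalised Haar measure is `c`. -/
def FunctionHasMean (f : G → ℂ) (c : ℂ) : Prop :=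
  ∃ F : C(BohrCompactification G, ℂ), (∀ x, F (toBohr x) = f x) ∧
    ∫ y, F y ∂(Measure.haarMeasure (⊤ : TopologicalSpace.PositiveCompacts (BohrCompactification G)))
      = c

variable [IsTopologicalAddGroup G] [MeasurableSpace G]

/-- `c` is the mean of the strongly almost periodic measure `μ`: it is the number such that
`M(φ * μ) = (∫ φ dm) · c` for all `φ ∈ C_c(G)`. Here `m` is the Haar measure of `G`. -/
def MeasureHasMean (m : Measure G) (μ : RadonMeasure G) (c : ℂ) : Prop :=
  ∀ φ : C_c(G, ℂ), FunctionHasMean (conv φ μ) ((∫ x, φ x ∂m) * c)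

/-! ### Generalized almost periodicity -/

/-- Real generalized-almost-periodic measures, for the Haar measure `m`. -/
def IsRealGeneralizedAlmostPeriodic (m : Measure G) (ρ : RadonMeasure G) : Prop :=
  ρ.IsReal ∧ IsTranslationBounded ρ ∧
    ∀ ε : ℝ, 0 < ε → ∃ μ ν : RadonMeasure G,
      IsStronglyAlmostPeriodic μ ∧ IsStronglyAlmostPeriodic ν ∧
      (ρ - μ).IsPositive ∧ (ν - ρ).IsPositive ∧
      ∃ c : ℝ, MeasureHasMean m (ν - μ) c ∧ c < ε

/-- Generalized-almost-periodic measures, for the Haar measure `m`. -/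
def IsGeneralizedAlmostPeriodic (m : Measure G) (ρ : RadonMeasure G) : Prop :=
  IsTranslationBounded ρ ∧ IsRealGeneralizedAlmostPeriodic m ρ.re ∧
    IsRealGeneralizedAlmostPeriodic m ρ.im

/-! ### Van Hove sequences, uniform upper density, Weyl almost periodicity -/

/-- The `K`-boundary `((A + K) ∩ (G ∖ A°)) ∪ ((-K + closure (G ∖ A)) ∩ A)` of `A`. -/
def vanHoveBoundary (K A : Set G) : Set G :=
  ((A + K) ∩ (interior A)ᶜ) ∪ ((-K + closure Aᶜ) ∩ A)

/-- Van Hove sequences in `G`, for the Haar measure `m`. -/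
def IsVanHoveSequence (m : Measure G) (A : ℕ → Set G) : Prop :=
  (∀ n, IsCompact (A n) ∧ 0 < m (A n)) ∧
    ∀ K : Set G, IsCompact K → Tendsto (fun n => m (vanHoveBoundary K (A n)) / m (A n)) atTop (𝓝 0)

/-- The uniform upper density `limsup_n sup_x |μ|(x + A_n) / |A_n|` of `μ`, computed along the
sequence `A`. -/
def uniformUpperDensity (m : Measure G) (A : ℕ → Set G) (μ : RadonMeasure G) : ℝ≥0∞ :=
  limsup (fun n => ⨆ x : G, μ.variation (x +ᵥ A n) / m (A n)) atTop

variable (G) in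
/-- The space of trigonometric polynomials: finite linear combinations of continuous characters. -/
def trigonometricPolynomials : Submodule ℂ (G → ℂ) :=
  Submodule.span ℂ (Set.range fun (χ : ContinuousCharacter G) (x : G) => (χ.1 x : ℂ))

/-- The Weyl seminorm `limsup_n sup_x (1/|A_n|) ∫_{A_n} |f(x - t)| dt`, computed along the
sequence `A`. -/
def weylSeminorm (m : Measure G) (A : ℕ → Set G) (f : G → ℂ) : ℝ≥0∞ :=
  limsup (fun n => ⨆ x : G, (∫⁻ t in A n, ‖f (x - t)‖ₑ ∂m) / m (A n)) atTop

/-- Weyl almost periodic functions. The approximation is required for all van Hove sequences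
(the seminorm does not depend on the van Hove sequence, and such sequences exist
in every σ-compact locally compact abelian group). -/
def IsWeylAlmostPeriodicFunction (m : Measure G) (f : G → ℂ) : Prop :=
  LocallyIntegrable f m ∧
    ∀ ε : ℝ, 0 < ε → ∃ P ∈ trigonometricPolynomials G,
      ∀ A : ℕ → Set G, IsVanHoveSequence m A → weylSeminorm m A (f - P) < ENNReal.ofReal ε

/-- Weyl almost periodic measures. -/
def IsWeylAlmostPeriodic (m : Measure G) (μ : RadonMeasure G) : Prop :=
  IsTranslationBounded μ ∧ ∀ φ : C_c(G, ℂ), IsWeylAlmostPeriodicFunction m (conv φ μ)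

end Groups

/-! ### Cut-and-project schemes and regular model sets -/

/-- A cut-and-project scheme over `G` with internal space `H`. -/
structure CutAndProjectScheme (G : Type*) [AddCommGroup G] [TopologicalSpace G]
    (H : Type*) [AddCommGroup H] [TopologicalSpace H] where
  /-- The lattice in `G × H`. -/
  lattice : AddSubgroup (G × H)
  discrete : DiscreteTopology lattice
  cocompact : CompactSpace ((G × H) ⧸ lattice)
  injective_fst : Function.Injective fun p : lattice => p.1.1
  dense_snd : DenseRange fun p : lattice => p.1.2

/-- The cut-and-project set `{x ∈ L : x^⋆ ∈ W}` with window `W`. -/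
def CutAndProjectScheme.cutAndProjectSet {G : Type*} [AddCommGroup G] [TopologicalSpace G]
    {H : Type*} [AddCommGroup H] [TopologicalSpace H] (S : CutAndProjectScheme G H) (W : Set H) :
    Set G :=
  {x | ∃ y ∈ W, (x, y) ∈ S.lattice}

/-- Regular model sets in `G`, with internal spaces `H` in the universe `v`. -/
def IsRegularModelSet.{u, v} {G : Type u} [AddCommGroup G] [TopologicalSpace G] (Λ : Set G) :
    Prop :=
  ∃ (H : Type v) (_ : AddCommGroup H) (_ : TopologicalSpace H) (_ : IsTopologicalAddGroup H)
    (_ : LocallyCompactSpace H) (_ : T2Space H) (_ : MeasurableSpace H) (_ : BorelSpace H)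
    (S : CutAndProjectScheme G H) (W : Set H),
    (interior W).Nonempty ∧ IsCompact (closure W) ∧
      (Measure.addHaar : Measure H) (frontier W) = 0 ∧ Λ = S.cutAndProjectSet W

/-! ### The example in the integers -/

/-- The set of all sums `∑_{j=0}^n c_j θ^j` with `n ∈ ℕ` and `c_j ∈ {0, 1}`. -/
def zeroOneSums (θ : ℝ) : Set ℝ :=
  {x | ∃ (n : ℕ) (c : ℕ → ℝ), (∀ j, c j = 0 ∨ c j = 1) ∧ x = ∑ j ∈ Finset.range (n + 1), c j * θ ^ j}

/-- The set `M_θ` of all integers `⌊x⌋` and `⌊x⌋ + 1`, with `x` such a sum. -/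
def thetaSet (θ : ℝ) : Set ℤ :=
  {k | ∃ x ∈ zeroOneSums θ, k = ⌊x⌋ ∨ k = ⌊x⌋ + 1}

/-- The Dirac comb of a set of integers. -/
def intComb (Λ : Set ℤ) : RadonMeasure ℤ := diracComb Λ (IsLocallyFiniteSet.of_discrete Λ)

end AlmostPeriodic

end

open AlmostPeriodic

universe u

/-!
# The integers outside `M_θ`

Two properties of `M = thetaSet θ` imply everything: `M` is small, in that it has zero Banach
density, and `M` is large, in that it is dense in `ℤ` for the topology of the Bohr compactification.

*Small.* The sums `x = ∑ c j * θ ^ j` with digits `0` and `1` form a set `S = θ S ∪ (1 + θ S)` whose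
points have mutual distance at least `1`. Hence an interval of length `θ ^ k / 2` contains at most
`2 ^ k` of them (`encard_zeroOneSums_inter_Icc_le`), and `M` has zero Banach density since `θ > 3`.
Averaging over intervals carries this over to all van Hove sequences
(`AlmostPeriodic.IsVanHoveSequence.eventually_card_filter_le`). The complement of `M` is therefore
relatively dense, and its Dirac comb agrees with that of `ℤ` up to uniform density zero; in
particular, it is Weyl almost periodic, with constants as approximating trigonometric polynomials.

*Large.* Let `u` be Bohr almost periodic on `ℤ`. Call a real number near zero if it is close to an
integer that is an almost period of `u`; the real line is precompact for this notion
(`isPrecompactGauge_of_isBohrAlmostPeriodic`). In a precompact group, the limit points of the sums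
of distinct terms of a sequence, with indices tending to infinity, form a closed semigroup, hence a
group. So `S` comes close to every difference of two sums of `B` elements of `S` with large exponents
(`IsPrecompactGauge.exists_tailSums_near_sub`), that is, to every value at `θ` of an integer
polynomial with coefficients bounded by `B` and without terms of low degree. If `B + 1 > θ` and `θ`
is transcendental, the pigeonhole principle shows that these values are dense in the real line
(`exists_polynomial_abs_sub_aeval_le`). Thus `S` is dense for the precompact topology. As `M`
contains both integers next to each `x ∈ S`, it follows that `u` on `M` comes close to every value of
`u` (`isBohrDense_thetaSet`).

*Consequences.* If `μ ≤ δ_Λ ≤ ν` with `Λ = ℤ \ M` and strongly almost periodic `μ` and `ν`, then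
`μ ≤ 0` on `M`, hence everywhere, while `ν ≥ 1` on `Λ`, hence everywhere. So `ν - μ` has mean at
least `1`, and `δ_Λ` is not generalized almost periodic. If `Λ` were given by a cut-and-project scheme
with window `W`, the lattice would be generated by a pair `(1, h)` with `ℤ • h` dense in a compact
group; by Bohr density of `M`, the interior of `W` would contain some `m • h` with `m ∈ M`.
-/

/-! ### Sets of integers of zero Banach density -/

/-- `N` has at most `c` elements in every interval of `L` consecutive integers. -/
def IntervalCountLE (N : Set ℤ) (L : ℕ) (c : ℝ) : Prop :=
  ∀ a : ℤ, ((N ∩ Set.Ico a (a + L)).ncard : ℝ) ≤ c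

/-- Sets of zero upper Banach density: among `L` consecutive integers there are at most `ε * L`
elements of `N`, for suitable `L`. -/
def HasZeroBanachDensity (N : Set ℤ) : Prop :=
  ∀ ε : ℝ, 0 < ε → ∃ L : ℕ, 0 < L ∧ IntervalCountLE N L (ε * L)

namespace IntervalCountLE

variable {N : Set ℤ} {L : ℕ} {c : ℝ}

theorem preimage_add_left (h : IntervalCountLE N L c) (x : ℤ) :
    IntervalCountLE {n | x + n ∈ N} L c := by
  intro a
  refine le_trans ?_ (h (x + a))
  rw [← Set.ncard_image_of_injective _ (add_right_injective x)]
  refine Nat.cast_le.2 (Set.ncard_le_ncard ?_ ((Set.finite_Ico _ _).inter_of_right _))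
  rintro _ ⟨n, ⟨hn, hn1, hn2⟩, rfl⟩
  exact ⟨hn, by dsimp only; omega, by dsimp only; omega⟩

theorem preimage_sub_left (h : IntervalCountLE N L c) (x : ℤ) :
    IntervalCountLE {n | x - n ∈ N} L c := by
  intro a
  refine le_trans ?_ (h (x - a - L + 1))
  rw [← Set.ncard_image_of_injective _ (sub_right_injective (b := x))]
  refine Nat.cast_le.2 (Set.ncard_le_ncard ?_ ((Set.finite_Ico _ _).inter_of_right _))
  rintro _ ⟨n, ⟨hn, hn1, hn2⟩, rfl⟩
  exact ⟨hn, by dsimp only; omega, by dsimp only; omega⟩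

open Classical in
/-- Counting the pairs `(a, j)` with `a ∈ A`, `j < L` and `a + j ∈ N` in two ways; the elements of
`A` that are not of the form `a + j` lie in the boundary of `A`. -/
theorem card_filter_mul_le (h : IntervalCountLE N L c) (A D : Finset ℤ)
    (hD : vanHoveBoundary (Set.Icc (-L : ℤ) L) (A : Set ℤ) ⊆ D) :
    ((A.filter (· ∈ N)).card : ℝ) * L ≤ A.card * c + D.card * L := by
  have h1 : ∀ j ∈ Finset.range L, (A.filter (· ∈ N)).card ≤
      (A.filter fun a => a + (j : ℤ) ∈ N).card + D.card := by
    intro j hj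
    rw [Finset.mem_range] at hj
    rw [← Finset.card_map (addRightEmbedding (j : ℤ)) (s := A.filter fun a => a + (j : ℤ) ∈ N)]
    refine (Finset.card_le_card fun a ha => ?_).trans (Finset.card_union_le _ _)
    rw [Finset.mem_filter] at ha
    rw [Finset.mem_union]
    by_cases haj : a - j ∈ A
    · left
      rw [Finset.mem_map]
      exact ⟨a - j, Finset.mem_filter.2 ⟨haj, by simpa using ha.2⟩, by simp⟩
    · right
      refine hD (Or.inr ⟨?_, ha.1⟩)
      rw [Set.mem_add]
      exact ⟨j, by simp only [Set.mem_neg, Set.mem_Icc]; omega, a - j,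
        subset_closure (by simpa using haj), by ring⟩
  have h2 : (A.filter (· ∈ N)).card * L ≤
      ∑ j ∈ Finset.range L, (A.filter fun a => a + (j : ℤ) ∈ N).card + D.card * L := by
    have := Finset.sum_le_sum h1
    rw [Finset.sum_add_distrib] at this
    simpa [mul_comm] using this
  have h3 : ∑ j ∈ Finset.range L, (A.filter fun a => a + (j : ℤ) ∈ N).card =
      ∑ a ∈ A, ((Finset.range L).filter fun j : ℕ => a + (j : ℤ) ∈ N).card := by
    simp only [Finset.card_filter]
    exact Finset.sum_comm
  have h4 : ∀ a ∈ A, (((Finset.range L).filter fun j : ℕ => a + (j : ℤ) ∈ N).card : ℝ) ≤ c := by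
    intro a _
    refine le_trans ?_ (h a)
    rw [Nat.cast_le, ← Set.ncard_coe_finset,
      ← Set.ncard_image_of_injective _ ((add_right_injective a).comp Nat.cast_injective)]
    refine Set.ncard_le_ncard ?_ ((Set.finite_Ico _ _).inter_of_right _)
    rintro _ ⟨j, hj, rfl⟩
    simp only [Finset.coe_filter, Finset.mem_range, Set.mem_ofPred_eq] at hj
    exact ⟨hj.2, by simp, by simpa using hj.1⟩
  have h5 := Finset.sum_le_sum h4
  rw [Finset.sum_const, nsmul_eq_mul] at h5
  have h6 : ((A.filter (· ∈ N)).card : ℝ) * L ≤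
      ((∑ a ∈ A, ((Finset.range L).filter fun j : ℕ => a + (j : ℤ) ∈ N).card : ℕ) : ℝ)
        + D.card * L := by
    rw [← h3]
    exact_mod_cast h2
  push_cast at h6
  linarith

end IntervalCountLE

theorem finite_vanHoveBoundary {L : ℕ} {A : Set ℤ} (hA : A.Finite) :
    (vanHoveBoundary (Set.Icc (-L : ℤ) L) A).Finite :=
  ((hA.add (Set.finite_Icc _ _)).inter_of_left _).union (hA.inter_of_right _)

open Classical in
/-- Along a van Hove sequence the boundary is negligible, so that the bound on intervals of length
`L` becomes a bound on `A n`, uniformly over all sets `N` with this bound. -/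
theorem AlmostPeriodic.IsVanHoveSequence.eventually_card_filter_le {A : ℕ → Set ℤ}
    (hA : IsVanHoveSequence Measure.count A) {ε : ℝ} (hε : 0 < ε) {L : ℕ} (hL : 0 < L) :
    ∀ᶠ n in atTop, ∃ F : Finset ℤ, A n = F ∧ 0 < F.card ∧
      ∀ N : Set ℤ, IntervalCountLE N L (ε * L) → ((F.filter (· ∈ N)).card : ℝ) ≤ 2 * ε * F.card := by
  have hlim := ENNReal.tendsto_nhds_zero.1 (hA.2 (Set.Icc (-L : ℤ) L) isCompact_Icc)
    (ENNReal.ofReal ε) (by simpa using hε)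
  filter_upwards [hlim] with n hn
  have hfin := isCompact_iff_finite.1 (hA.1 n).1
  have hpos := (hA.1 n).2
  obtain ⟨F, hF⟩ : ∃ F : Finset ℤ, A n = F := ⟨hfin.toFinset, by simp⟩
  obtain ⟨D, hD⟩ : ∃ D : Finset ℤ, vanHoveBoundary (Set.Icc (-L : ℤ) L) (A n) = D :=
    ⟨(finite_vanHoveBoundary (L := L) hfin).toFinset, by simp⟩
  rw [hD, hF, Measure.count_apply_finset, Measure.count_apply_finset] at hn
  rw [hF, Measure.count_apply_finset] at hpos
  have hF0 : 0 < F.card := by exact_mod_cast hpos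
  refine ⟨F, hF, hF0, fun N hN => ?_⟩
  have hDF : (D.card : ℝ) ≤ ε * F.card := by
    rw [ENNReal.div_le_iff (by exact_mod_cast hF0.ne') (by simp)] at hn
    have h1 : ENNReal.ofReal (D.card : ℝ) ≤ ENNReal.ofReal (ε * F.card) := by
      rw [ENNReal.ofReal_mul hε.le]
      simpa using hn
    exact (ENNReal.ofReal_le_ofReal_iff (by positivity)).1 h1
  have h1 := hN.card_filter_mul_le F D (by rw [← hD, hF])
  have hL' : (0 : ℝ) < L := by exact_mod_cast hL
  refine le_of_mul_le_mul_right ?_ hL'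
  nlinarith

namespace HasZeroBanachDensity

variable {N : Set ℤ}

/-- Finitely many translates of a set of zero Banach density do not cover the integers, since they
contain only a small part of a long interval. -/
theorem exists_forall_add_notMem (hN : HasZeroBanachDensity N) (F : Finset ℤ) :
    ∃ n, ∀ f ∈ F, n + f ∉ N := by
  classical
  by_contra! hcon
  obtain ⟨L, hL, h⟩ := hN (1 / (F.card + 1)) (by positivity)
  have h1 : (Finset.Ico (0 : ℤ) L).card ≤
      ∑ f ∈ F, ((Finset.Ico (0 : ℤ) L).filter fun n => f + n ∈ N).card := by
    refine le_trans (Finset.card_le_card fun n hn => ?_) Finset.card_biUnion_le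
    obtain ⟨f, hf, hnf⟩ := hcon n
    exact Finset.mem_biUnion.2 ⟨f, hf, Finset.mem_filter.2 ⟨hn, by rwa [add_comm]⟩⟩
  have h2 : ∀ f ∈ F, (((Finset.Ico (0 : ℤ) L).filter fun n => f + n ∈ N).card : ℝ) ≤
      1 / (F.card + 1) * L := by
    intro f _
    refine le_trans (le_of_eq ?_) (h.preimage_add_left f 0)
    rw [← Set.ncard_coe_finset]
    congr 2
    ext n
    simp [and_comm]
  have h3 := Finset.sum_le_sum h2
  rw [Finset.sum_const, nsmul_eq_mul] at h3
  have h4 : (L : ℝ) ≤ F.card * (1 / (F.card + 1) * L) := by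
    refine le_trans ?_ h3
    have : (L : ℕ) ≤ ∑ f ∈ F, ((Finset.Ico (0 : ℤ) L).filter fun n => f + n ∈ N).card := by
      simpa using h1
    exact_mod_cast this
  have hL' : (0 : ℝ) < L := by exact_mod_cast hL
  have h5 : (F.card : ℝ) * (1 / (F.card + 1) * L) = L * (F.card / (F.card + 1)) := by ring
  have h6 : (F.card : ℝ) / (F.card + 1) < 1 := by
    rw [div_lt_one (by positivity)]
    linarith
  nlinarith

theorem isRelativelyDense_compl (hN : HasZeroBanachDensity N) :
    IsRelativelyDense (Set.univ \ N) := by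
  obtain ⟨L, hL, h⟩ := hN (1 / 2) (by norm_num)
  refine ⟨Set.Ioc (-L : ℤ) 0, (Set.finite_Ioc _ _).isCompact, Set.eq_univ_of_forall fun n => ?_⟩
  by_contra hn
  have hsub : N ∩ Set.Ico n (n + L) = Set.Ico n (n + L) := by
    refine Set.inter_eq_right.2 fun m hm => ?_
    by_contra hmN
    refine hn (Set.mem_add.2 ⟨m, ⟨trivial, hmN⟩, n - m, ?_, by ring⟩)
    have := hm.1
    have := hm.2
    constructor <;> omega
  have h1 := h n
  rw [hsub, ← Finset.coe_Ico, Set.ncard_coe_finset, Int.card_Ico] at h1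
  simp only [add_sub_cancel_left, Int.toNat_natCast] at h1
  have hL' : (0 : ℝ) < L := by exact_mod_cast hL
  linarith

end HasZeroBanachDensity

/-! ### Dirac combs on the integers -/

theorem intComb_eval (Λ : Set ℤ) [DecidablePred (· ∈ Λ)] (φ : C_c(ℤ, ℂ)) {F : Finset ℤ}
    (hF : Function.support φ ⊆ F) : (intComb Λ).eval φ = ∑ n ∈ F, if n ∈ Λ then φ n else 0 := by
  change ∑ᶠ x : Λ, φ x = _
  rw [finsum_subtype_eq_finsum_cond (f := φ) (· ∈ Λ), finsum_mem_def,
    finsum_eq_sum_of_support_subset (s := F)]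
  · exact Finset.sum_congr rfl fun n _ => by simp [Set.indicator_apply]
  · exact fun n hn => hF fun h0 => hn (by simp [Set.indicator_apply, h0])

theorem intComb_compl_sub_univ_eval (N : Set ℤ) [DecidablePred (· ∈ N)] (φ : C_c(ℤ, ℂ))
    {F : Finset ℤ} (hF : Function.support φ ⊆ F) :
    (intComb (Set.univ \ N) - intComb Set.univ).eval φ = -∑ n ∈ F, if n ∈ N then φ n else 0 := by
  classical
  change (intComb (Set.univ \ N)).eval φ - (intComb Set.univ).eval φ = _
  rw [intComb_eval _ φ hF, intComb_eval _ φ hF, ← Finset.sum_sub_distrib, ← Finset.sum_neg_distrib]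
  refine Finset.sum_congr rfl fun n _ => ?_
  by_cases h : n ∈ N <;> simp [h]

theorem exists_finset_support_subset (φ : C_c(ℤ, ℂ)) : ∃ F : Finset ℤ, Function.support φ ⊆ F :=
  ⟨(isCompact_iff_finite.1 φ.hasCompactSupport).toFinset, by simpa using subset_tsupport φ⟩

theorem conv_intComb (Λ : Set ℤ) [DecidablePred (· ∈ Λ)] (φ : C_c(ℤ, ℂ)) {F : Finset ℤ}
    (hF : Function.support φ ⊆ F) (x : ℤ) :
    conv φ (intComb Λ) x = ∑ s ∈ F, if x - s ∈ Λ then φ s else 0 := by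
  classical
  rw [conv, intComb_eval Λ (reflectTranslate φ x) (F := F.image (x - ·))]
  · rw [Finset.sum_image fun a _ b _ h => sub_right_injective h]
    refine Finset.sum_congr rfl fun s _ => ?_
    change (if x - s ∈ Λ then φ (x - (x - s)) else 0) = _
    rw [sub_sub_cancel]
  · intro t ht
    have : x - t ∈ F := hF ht
    rw [Finset.mem_coe, Finset.mem_image]
    exact ⟨x - t, this, by ring⟩

theorem isTranslationBounded_intComb (Λ : Set ℤ) : IsTranslationBounded (intComb Λ) := by
  classical
  intro φ
  obtain ⟨F, hF⟩ := exists_finset_support_subset φ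
  refine ⟨∑ s ∈ F, ‖φ s‖, fun x => ?_⟩
  rw [conv_intComb Λ φ hF]
  refine (norm_sum_le _ _).trans (Finset.sum_le_sum fun s _ => ?_)
  split_ifs <;> simp

/-- With `Λ = ℤ \ N`, the total variation of `δ_Λ - δ_ℤ = -δ_N` on a finite set `K` is at most the
number of elements of `N` in `K`, since the indicator function of `K` is continuous. -/
theorem variation_compl_sub_univ_le (N : Set ℤ) [DecidablePred (· ∈ N)] (K : Finset ℤ) :
    (intComb (Set.univ \ N) - intComb Set.univ).variation (K : Set ℤ) ≤
      ((K.filter (· ∈ N)).card : ℝ≥0∞) := by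
  let φ : C_c(ℤ, ℝ) :=
    { toFun := fun n => if n ∈ K then 1 else 0
      continuous_toFun := continuous_of_discreteTopology
      hasCompactSupport' := HasCompactSupport.intro K.finite_toSet.isCompact
        fun n hn => if_neg (by simpa using hn) }
  have hφ : ∀ n, φ n = if n ∈ K then 1 else 0 := fun _ => rfl
  have hφ0 : ∀ n, 0 ≤ φ n := fun n => by rw [hφ]; split_ifs <;> simp
  have hφ1 : ∀ n ∈ (K : Set ℤ), 1 ≤ φ n := fun n hn => by rw [hφ, if_pos (by simpa using hn)]
  refine (iInf_le _ ⟨φ, hφ0, hφ1⟩).trans (iSup_le fun ψ => ?_)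
  have hsupp : Function.support ψ.1 ⊆ K := by
    intro n hn
    by_contra hnK
    refine hn (norm_le_zero_iff.1 ((ψ.2 n).trans_eq ?_))
    change φ n = 0
    rw [hφ, if_neg (by simpa using hnK)]
  rw [intComb_compl_sub_univ_eval N ψ.1 hsupp, enorm_neg, ← Finset.sum_filter]
  refine (enorm_sum_le _ _).trans ?_
  rw [Finset.card_eq_sum_ones, Nat.cast_sum]
  refine Finset.sum_le_sum fun n _ => ?_
  have h1 : ‖ψ.1 n‖ ≤ 1 := by
    refine (ψ.2 n).trans ?_
    change φ n ≤ 1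
    rw [hφ]
    split_ifs <;> simp
  rw [← ofReal_norm]
  simpa using ENNReal.ofReal_le_ofReal h1

/-! ### Complements of sets of zero Banach density -/

namespace HasZeroBanachDensity

variable {N : Set ℤ}

theorem uniformUpperDensity_eq_zero (hN : HasZeroBanachDensity N) {A : ℕ → Set ℤ}
    (hA : IsVanHoveSequence Measure.count A) :
    uniformUpperDensity Measure.count A (intComb (Set.univ \ N) - intComb Set.univ) = 0 := by
  classical
  refine le_antisymm (ENNReal.le_of_forall_pos_le_add fun ε hε _ => ?_) bot_le
  rw [zero_add]
  obtain ⟨L, hL, h⟩ := hN (ε / 2) (by positivity)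
  refine limsup_le_of_le (by isBoundedDefault) ?_
  filter_upwards [hA.eventually_card_filter_le (show 0 < (ε : ℝ) / 2 by positivity) hL] with n hn
  obtain ⟨F, hF, hF0, hcount⟩ := hn
  rw [hF, Measure.count_apply_finset]
  refine iSup_le fun x => ?_
  rw [ENNReal.div_le_iff (by exact_mod_cast hF0.ne') (by simp)]
  have hx : (x +ᵥ (F : Set ℤ)) = ((F.map (addLeftEmbedding x) : Finset ℤ) : Set ℤ) := by
    ext n
    simp only [Set.mem_vadd_set, Finset.coe_map, Set.mem_image, vadd_eq_add, addLeftEmbedding_apply]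
  rw [hx]
  refine (variation_compl_sub_univ_le N _).trans ?_
  rw [Finset.filter_map, Finset.card_map]
  have h1 := hcount _ (h.preimage_add_left x)
  rw [mul_div_cancel₀ _ (two_ne_zero)] at h1
  have h2 := ENNReal.ofReal_le_ofReal h1
  rw [ENNReal.ofReal_mul (by positivity)] at h2
  simpa [Function.comp_def] using h2

/-- The approximating trigonometric polynomial is the constant `∑ s, φ s`. -/
theorem isWeylAlmostPeriodic (hN : HasZeroBanachDensity N) :
    IsWeylAlmostPeriodic Measure.count (intComb (Set.univ \ N)) := by
  classical
  refine ⟨isTranslationBounded_intComb _, fun φ => ⟨?_, fun ε hε => ?_⟩⟩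
  · intro x
    refine ⟨{x}, by simp,
      integrableOn_singleton (hx := (Measure.count_singleton x).trans_lt ENNReal.one_lt_top)⟩
  obtain ⟨F, hF⟩ := exists_finset_support_subset φ
  set C : ℝ := ∑ s ∈ F, ‖φ s‖ with hC
  have hC0 : 0 ≤ C := by positivity
  refine ⟨fun _ => ∑ s ∈ F, φ s, ?_, fun A hA => ?_⟩
  · have h1 : (∑ s ∈ F, φ s) • (fun _ : ℤ => (1 : ℂ)) ∈ trigonometricPolynomials ℤ := by
      refine Submodule.smul_mem _ _ (Submodule.subset_span
        ⟨⟨1, continuous_of_discreteTopology⟩, ?_⟩)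
      funext x
      simp
    convert h1 using 1
    funext x
    simp
  set δ : ℝ := ε / (4 * (C + 1)) with hδ
  have hδ0 : 0 < δ := by positivity
  obtain ⟨L, hL, h⟩ := hN δ hδ0
  refine lt_of_le_of_lt (b := ENNReal.ofReal (ε / 2)) (limsup_le_of_le (by isBoundedDefault) ?_)
    ((ENNReal.ofReal_lt_ofReal_iff hε).2 (by linarith))
  filter_upwards [hA.eventually_card_filter_le hδ0 hL] with n hn
  obtain ⟨K, hK, hK0, hcount⟩ := hn
  rw [hK, Measure.count_apply_finset]
  refine iSup_le fun x => ?_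
  rw [ENNReal.div_le_iff (by exact_mod_cast hK0.ne') (by simp), lintegral_finset]
  have hpt : ∀ y, ‖conv φ (intComb (Set.univ \ N)) y - ∑ s ∈ F, φ s‖ ≤
      ∑ s ∈ F, if y - s ∈ N then ‖φ s‖ else 0 := by
    intro y
    rw [conv_intComb _ φ hF, ← Finset.sum_sub_distrib]
    refine (norm_sum_le _ _).trans (Finset.sum_le_sum fun s _ => ?_)
    by_cases hs : y - s ∈ N <;> simp [hs]
  have hsum : ∑ t ∈ K, ‖conv φ (intComb (Set.univ \ N)) (x - t) - ∑ s ∈ F, φ s‖ ≤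
      ε / 2 * K.card := by
    calc _ ≤ ∑ t ∈ K, ∑ s ∈ F, (if x - t - s ∈ N then ‖φ s‖ else 0) :=
          Finset.sum_le_sum fun t _ => hpt _
      _ = ∑ s ∈ F, ((K.filter fun t => x - s - t ∈ N).card : ℝ) * ‖φ s‖ := by
          rw [Finset.sum_comm]
          refine Finset.sum_congr rfl fun s _ => ?_
          rw [← Finset.sum_filter, Finset.sum_const, nsmul_eq_mul]
          simp only [sub_right_comm x]
      _ ≤ ∑ s ∈ F, (2 * δ * K.card) * ‖φ s‖ := by
          refine Finset.sum_le_sum fun s _ => ?_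
          exact mul_le_mul_of_nonneg_right (hcount _ (h.preimage_sub_left (x - s))) (norm_nonneg _)
      _ = 2 * δ * C * K.card := by
          rw [← Finset.mul_sum]
          ring
      _ ≤ ε / 2 * K.card := by
          refine mul_le_mul_of_nonneg_right ?_ (by positivity)
          rw [hδ, mul_div_assoc', div_mul_eq_mul_div, div_le_iff₀ (by positivity)]
          nlinarith
  have h2 := ENNReal.ofReal_le_ofReal hsum
  rw [ENNReal.ofReal_mul (by positivity), ENNReal.ofReal_sum_of_nonneg fun _ _ => norm_nonneg _]
    at h2
  simpa [Pi.sub_apply] using h2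

end HasZeroBanachDensity

/-! ### The set `M_θ` has zero Banach density -/

theorem sum_range_succ_mul_pow (c : ℕ → ℝ) (θ : ℝ) (n : ℕ) :
    ∑ j ∈ Finset.range (n + 1), c j * θ ^ j =
      c 0 + θ * ∑ j ∈ Finset.range n, c (j + 1) * θ ^ j := by
  rw [Finset.sum_range_succ', Finset.mul_sum, add_comm]
  congr 1
  · simp
  · exact Finset.sum_congr rfl fun j _ => by ring

theorem exists_eq_add_mul_of_mem_zeroOneSums {θ x : ℝ} (hx : x ∈ zeroOneSums θ) :
    ∃ c y : ℝ, (c = 0 ∨ c = 1) ∧ y ∈ zeroOneSums θ ∧ x = c + θ * y := by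
  obtain ⟨n, c, hc, rfl⟩ := hx
  cases n with
  | zero => exact ⟨c 0, 0, hc 0, ⟨0, fun _ => 0, by simp, by simp⟩, by simp⟩
  | succ n =>
    exact ⟨c 0, _, hc 0, ⟨n, fun j => c (j + 1), fun j => hc _, rfl⟩,
      sum_range_succ_mul_pow c θ (n + 1)⟩

/-- Distinct sums have distance at least `1`: if they have different digits from index `1` on, then
the tails have distance at least `θ`, by induction, and the first digits change this by at most
`1`. -/
theorem one_le_abs_sub_of_mem_zeroOneSums {θ : ℝ} (h2 : 2 ≤ θ) {x y : ℝ} (hx : x ∈ zeroOneSums θ)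
    (hy : y ∈ zeroOneSums θ) (hxy : x ≠ y) : 1 ≤ |x - y| := by
  have key : ∀ (n : ℕ) (c d : ℕ → ℝ), (∀ j, c j = 0 ∨ c j = 1) → (∀ j, d j = 0 ∨ d j = 1) →
      ∑ j ∈ Finset.range n, c j * θ ^ j ≠ ∑ j ∈ Finset.range n, d j * θ ^ j →
      1 ≤ |∑ j ∈ Finset.range n, c j * θ ^ j - ∑ j ∈ Finset.range n, d j * θ ^ j| := by
    intro n
    induction n with
    | zero => simp
    | succ n ih =>
      intro c d hc hd hne
      rw [sum_range_succ_mul_pow, sum_range_succ_mul_pow] at hne ⊢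
      have ih' := ih (fun j => c (j + 1)) (fun j => d (j + 1)) (fun j => hc _) (fun j => hd _)
      set s := ∑ j ∈ Finset.range n, c (j + 1) * θ ^ j
      set t := ∑ j ∈ Finset.range n, d (j + 1) * θ ^ j
      by_cases hst : s = t
      · rw [hst] at hne ⊢
        rcases hc 0 with h | h <;> rcases hd 0 with h' | h' <;> rw [h, h'] at hne ⊢ <;>
          first | exact absurd rfl hne | norm_num
      · have h1 := ih' hst
        rw [le_abs] at h1 ⊢
        rcases h1 with h1 | h1
        · left
          have : θ * 1 ≤ θ * (s - t) := mul_le_mul_of_nonneg_left h1 (by linarith)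
          rcases hc 0 with h | h <;> rcases hd 0 with h' | h' <;> rw [h, h'] <;> linarith
        · right
          have : θ * 1 ≤ θ * -(s - t) := mul_le_mul_of_nonneg_left h1 (by linarith)
          rcases hc 0 with h | h <;> rcases hd 0 with h' | h' <;> rw [h, h'] <;> linarith
  have pad : ∀ {x : ℝ}, x ∈ zeroOneSums θ → ∃ (n : ℕ) (c : ℕ → ℝ), (∀ j, c j = 0 ∨ c j = 1) ∧
      ∀ m, n ≤ m → x = ∑ j ∈ Finset.range m, c j * θ ^ j := by
    rintro x ⟨n, c, hc, rfl⟩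
    refine ⟨n + 1, fun j => if j < n + 1 then c j else 0, fun j => ?_, fun m hm => ?_⟩
    · by_cases hj : j < n + 1
      · simpa [hj] using hc j
      · simp [hj]
    · dsimp only
      rw [← Finset.sum_subset (Finset.range_mono hm)]
      · exact Finset.sum_congr rfl fun j hj => by simp only [if_pos (Finset.mem_range.1 hj)]
      · intro j _ hj
        rw [if_neg (by simpa [Finset.mem_range] using hj), zero_mul]
  obtain ⟨n, c, hc, hx⟩ := pad hx
  obtain ⟨m, d, hd, hy⟩ := pad hy
  rw [hx _ (le_max_left n m), hy _ (le_max_right n m)] at hxy ⊢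
  exact key _ c d hc hd hxy

/-- The set `S` of all sums satisfies `S = θ S ∪ (1 + θ S)`, so that scaling an interval by `θ` at
most doubles the number of its points in `S`. -/
theorem encard_zeroOneSums_inter_Icc_le {θ : ℝ} (h2 : 2 ≤ θ) (k : ℕ) {a b : ℝ}
    (hab : b - a ≤ θ ^ k / 2) : (zeroOneSums θ ∩ Set.Icc a b).encard ≤ 2 ^ k := by
  have hθ0 : 0 < θ := by linarith
  induction k generalizing a b with
  | zero =>
    rw [pow_zero, Set.encard_le_one_iff]
    rintro x y ⟨hx, hx1, hx2⟩ ⟨hy, hy1, hy2⟩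
    by_contra hxy
    have h1 := one_le_abs_sub_of_mem_zeroOneSums h2 hx hy hxy
    have h3 : |x - y| ≤ 1 / 2 := by
      rw [pow_zero] at hab
      rw [abs_le]
      constructor <;> linarith
    linarith
  | succ k ih =>
    have hsub : zeroOneSums θ ∩ Set.Icc a b ⊆
        ((θ * ·) '' (zeroOneSums θ ∩ Set.Icc (a / θ) (b / θ))) ∪
        ((1 + θ * ·) '' (zeroOneSums θ ∩ Set.Icc ((a - 1) / θ) ((b - 1) / θ))) := by
      rintro x ⟨hx, hxa, hxb⟩
      obtain ⟨c, y, rfl | rfl, hy, rfl⟩ := exists_eq_add_mul_of_mem_zeroOneSums hx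
      · refine Or.inl ⟨y, ⟨hy, ?_, ?_⟩, by simp⟩
        · rw [div_le_iff₀ hθ0]; linarith
        · rw [le_div_iff₀ hθ0]; linarith
      · refine Or.inr ⟨y, ⟨hy, ?_, ?_⟩, by simp⟩
        · rw [div_le_iff₀ hθ0]; linarith
        · rw [le_div_iff₀ hθ0]; linarith
    have hlen : ∀ {a b : ℝ}, b - a ≤ θ ^ (k + 1) / 2 → b / θ - a / θ ≤ θ ^ k / 2 := by
      intro a b hab
      rw [← sub_div, div_le_iff₀ hθ0]
      calc b - a ≤ θ ^ (k + 1) / 2 := hab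
        _ = _ := by ring
    refine (Set.encard_le_encard hsub).trans ((Set.encard_union_le _ _).trans ?_)
    rw [pow_succ, mul_two]
    exact add_le_add ((Set.encard_image_le _ _).trans (ih (hlen hab)))
      ((Set.encard_image_le _ _).trans (ih (hlen (by linarith))))

/-- An interval of length about `θ ^ k / 2` contains at most `2 ^ (k + 1)` elements of `M_θ`. -/
theorem hasZeroBanachDensity_thetaSet {θ : ℝ} (h3 : 3 < θ) :
    HasZeroBanachDensity (thetaSet θ) := by
  intro ε hε
  obtain ⟨k, hk⟩ := pow_unbounded_of_one_lt (4 / ε + 4) (show (1 : ℝ) < 3 / 2 by norm_num)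
  rw [div_pow, lt_div_iff₀ (by positivity)] at hk
  have hpow : (3 : ℝ) ^ k ≤ θ ^ k := by gcongr
  have h2k : (1 : ℝ) ≤ 2 ^ k := one_le_pow₀ (by norm_num)
  have hε' : 0 < 4 / ε * 2 ^ k := by positivity
  set L := ⌊θ ^ k / 2 - 1⌋₊ with hL
  have hL1 : (L : ℝ) ≤ θ ^ k / 2 - 1 := Nat.floor_le (by linarith)
  have hL2 : θ ^ k / 2 - 1 < L + 1 := Nat.lt_floor_add_one _
  have hL3 : 2 / ε * 2 ^ k < L := by
    have : 2 / ε * 2 ^ k = (4 / ε * 2 ^ k) / 2 := by ring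
    linarith
  refine ⟨L, by exact_mod_cast (show 0 < 2 / ε * 2 ^ k by positivity).trans hL3, fun a => ?_⟩
  have hsub : thetaSet θ ∩ Set.Ico a (a + L) ⊆
      (Int.floor '' (zeroOneSums θ ∩ Set.Icc ((a : ℝ) - 1) (a + L))) ∪
      ((fun x => ⌊x⌋ + 1) '' (zeroOneSums θ ∩ Set.Icc ((a : ℝ) - 1) (a + L))) := by
    rintro m ⟨⟨x, hx, hm⟩, hma, hmb⟩
    have hma' : (a : ℝ) ≤ m := by exact_mod_cast hma
    have hmb' : (m : ℝ) + 1 ≤ a + L := by exact_mod_cast hmb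
    have h1 := Int.floor_le x
    have h2 := Int.lt_floor_add_one x
    have hx' : x ∈ Set.Icc ((a : ℝ) - 1) (a + L) := by
      rcases hm with rfl | rfl
      · constructor <;> linarith
      · push_cast at hma' hmb'
        constructor <;> linarith
    rcases hm with rfl | rfl
    · exact Or.inl ⟨x, ⟨hx, hx'⟩, rfl⟩
    · exact Or.inr ⟨x, ⟨hx, hx'⟩, rfl⟩
  have hcount := encard_zeroOneSums_inter_Icc_le (show 2 ≤ θ by linarith) k
    (a := (a : ℝ) - 1) (b := a + L) (by linarith)
  have h1 : (thetaSet θ ∩ Set.Ico a (a + L)).encard ≤ (2 ^ k + 2 ^ k : ℕ) := by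
    refine (Set.encard_le_encard hsub).trans ((Set.encard_union_le _ _).trans ?_)
    push_cast
    exact add_le_add ((Set.encard_image_le _ _).trans hcount)
      ((Set.encard_image_le _ _).trans hcount)
  rw [← ((Set.finite_Ico a (a + L)).inter_of_right _).cast_ncard_eq, Nat.cast_le] at h1
  have h4 : ((thetaSet θ ∩ Set.Ico a (a + L)).ncard : ℝ) ≤ 2 ^ k + 2 ^ k := by exact_mod_cast h1
  have h5 : ε * (2 / ε * 2 ^ k) = 2 ^ k + 2 ^ k := by
    field_simp
    ring
  nlinarith [mul_lt_mul_of_pos_left hL3 hε]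

/-! ### Small values of integer polynomials with bounded digits -/

section Digits

open Polynomial

/-- Pigeonhole: since `B + 1 > θ`, two of the `(B + 1) ^ m` sums `∑ i < m, c i * θ ^ i` with digits
in `{0, …, B}` are close to each other, and they differ because `θ` is transcendental. -/
theorem exists_polynomial_aeval_pos_lt {θ : ℝ} (hθ : Transcendental ℚ θ) (h2 : 2 ≤ θ) {B : ℕ}
    (hB : θ < B + 1) {η : ℝ} (hη : 0 < η) :
    ∃ p : ℤ[X], (∀ j, |p.coeff j| ≤ B) ∧ 0 < aeval θ p ∧ aeval θ p < η := by
  have hθ0 : 0 < θ := by linarith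
  obtain ⟨m, hm⟩ := pow_unbounded_of_one_lt ((B : ℝ) / η + 1)
    (show 1 < ((B : ℝ) + 1) / θ by rwa [one_lt_div hθ0])
  rw [div_pow, lt_div_iff₀ (by positivity)] at hm
  let v : (Fin m → Fin (B + 1)) → ℝ := fun c => ∑ i, (c i : ℝ) * θ ^ (i : ℕ)
  have hv0 : ∀ c, 0 ≤ v c := fun c => Finset.sum_nonneg fun i _ => by positivity
  have hv : ∀ c, v c ≤ B * θ ^ m := by
    intro c
    have h1 : v c ≤ ∑ i ∈ Finset.range m, (B : ℝ) * θ ^ i := by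
      rw [← Fin.sum_univ_eq_sum_range (fun i => (B : ℝ) * θ ^ i)]
      refine Finset.sum_le_sum fun i _ => ?_
      have : ((c i : ℕ) : ℝ) ≤ B := by exact_mod_cast Nat.lt_succ_iff.1 (c i).2
      gcongr
    have h2 : (∑ i ∈ Finset.range m, θ ^ i) ≤ θ ^ m := by
      have h3 := geom_sum_mul θ m
      have h4 : 0 ≤ ∑ i ∈ Finset.range m, θ ^ i := by positivity
      nlinarith
    rw [← Finset.mul_sum] at h1
    exact h1.trans (by gcongr)
  obtain ⟨c, -, d, -, hcd, hbin⟩ := Finset.exists_ne_map_eq_of_card_lt_of_maps_to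
    (s := (Finset.univ : Finset (Fin m → Fin (B + 1))))
    (t := Finset.range (⌊(B : ℝ) * θ ^ m / η⌋₊ + 1)) (f := fun c => ⌊v c / η⌋₊)
    (by
      rw [Finset.card_range, Finset.card_univ, Fintype.card_fun, Fintype.card_fin, Fintype.card_fin]
      have h1 : ((⌊(B : ℝ) * θ ^ m / η⌋₊ + 1 : ℕ) : ℝ) < ((B + 1) ^ m : ℕ) := by
        push_cast
        have h2 := Nat.floor_le (show 0 ≤ (B : ℝ) * θ ^ m / η by positivity)
        have h3 : 1 ≤ θ ^ m := one_le_pow₀ (by linarith)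
        have h4 : ((B : ℝ) / η + 1) * θ ^ m = B * θ ^ m / η + θ ^ m := by ring
        linarith
      exact_mod_cast h1)
    (by
      intro c _
      simp only [Finset.coe_range, Set.mem_Iio, Nat.lt_succ_iff]
      exact Nat.floor_le_floor (div_le_div_of_nonneg_right (hv c) hη.le))
  have hclose : |v c - v d| < η := by
    have hc1 := Nat.floor_le (div_nonneg (hv0 c) hη.le)
    have hc2 := Nat.lt_floor_add_one (v c / η)
    have hd1 := Nat.floor_le (div_nonneg (hv0 d) hη.le)
    have hd2 := Nat.lt_floor_add_one (v d / η)
    rw [hbin] at hc1 hc2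
    have h : |v c / η - v d / η| < 1 := by rw [abs_lt]; constructor <;> linarith
    rwa [← sub_div, abs_div, abs_of_pos hη, div_lt_one hη] at h
  let P : (Fin m → Fin (B + 1)) → (Fin m → Fin (B + 1)) → ℤ[X] := fun c d =>
    ∑ i : Fin m, C ((c i : ℤ) - (d i : ℤ)) * X ^ (i : ℕ)
  have hP : ∀ c d, aeval θ (P c d) = v c - v d := by
    intro c d
    simp only [P, v, map_sum, map_mul, aeval_C, map_pow, aeval_X, ← Finset.sum_sub_distrib]
    refine Finset.sum_congr rfl fun i _ => ?_
    simp [sub_mul]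
  have hcoeff : ∀ c d (i : Fin m), (P c d).coeff i = (c i : ℤ) - (d i : ℤ) := by
    intro c d i
    simp only [P, finsetSum_coeff, coeff_C_mul, coeff_X_pow]
    rw [Finset.sum_eq_single i] <;> simp +contextual [Fin.ext_iff, eq_comm]
  have hdig : ∀ c d j, |(P c d).coeff j| ≤ B := by
    intro c d j
    by_cases hj : j < m
    · have h := hcoeff c d ⟨j, hj⟩
      simp only at h
      rw [h, abs_le]
      have h1 := (c ⟨j, hj⟩).2
      have h2 := (d ⟨j, hj⟩).2
      constructor <;> omega
    · have : (P c d).coeff j = 0 := by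
        simp only [P, finsetSum_coeff, coeff_C_mul, coeff_X_pow]
        refine Finset.sum_eq_zero fun i _ => ?_
        have := i.2
        rw [if_neg (by omega), mul_zero]
      simp [this]
  have hne : v c - v d ≠ 0 := by
    intro h0
    have hθZ : Transcendental ℤ θ := hθ.restrictScalars (Int.cast_injective)
    have hP0 := transcendental_iff.1 hθZ (P c d) (by rw [hP, h0])
    refine hcd (funext fun i => Fin.ext ?_)
    have := hcoeff c d i
    rw [hP0, coeff_zero] at this
    omega
  rcases lt_or_gt_of_ne hne with h | h
  · refine ⟨P d c, hdig d c, ?_, ?_⟩ <;> rw [hP]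
    · linarith
    · rw [abs_of_neg h] at hclose; linarith
  · refine ⟨P c d, hdig c d, ?_, ?_⟩ <;> rw [hP]
    · exact h
    · rwa [abs_of_pos h] at hclose

/-- Multiplication by a power of `X` brings a small value to any given scale, up to a factor `θ`,
and moves the exponents beyond any given bound. -/
theorem exists_polynomial_aeval_mem_Ioc {θ : ℝ} (hθ : Transcendental ℚ θ) (h2 : 2 ≤ θ) {B : ℕ}
    (hB : θ < B + 1) {η : ℝ} (hη : 0 < η) (N : ℕ) :
    ∃ p : ℤ[X], (∀ j, |p.coeff j| ≤ B) ∧ (∀ j < N, p.coeff j = 0) ∧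
      aeval θ p ∈ Set.Ioc (η / θ) η := by
  have hθ0 : 0 < θ := by linarith
  have hN : 1 ≤ θ ^ N := one_le_pow₀ (by linarith)
  obtain ⟨p, hp, hpos, hlt⟩ := exists_polynomial_aeval_pos_lt hθ h2 hB
    (show 0 < η / θ ^ N by positivity)
  have hlt' : θ ^ N < η / aeval θ p := by
    rw [lt_div_iff₀ (by positivity)] at hlt ⊢
    linarith
  obtain ⟨n, hn1, hn2⟩ := exists_nat_pow_near (hN.trans hlt'.le) (show 1 < θ by linarith)
  have hNn : N ≤ n :=
    Nat.lt_succ_iff.1 ((pow_lt_pow_iff_right₀ (by linarith)).1 (hlt'.trans hn2))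
  refine ⟨p * X ^ n, fun j => ?_, fun j hj => ?_, ?_, ?_⟩
  · rw [coeff_mul_X_pow']
    split_ifs
    · exact hp _
    · simp
  · rw [coeff_mul_X_pow', if_neg (by omega)]
  · rw [map_mul, map_pow, aeval_X, div_lt_iff₀ hθ0]
    rw [div_lt_iff₀ hpos] at hn2
    calc η < θ ^ (n + 1) * aeval θ p := hn2
      _ = _ := by ring
  · rw [map_mul, map_pow, aeval_X]
    rw [le_div_iff₀ hpos] at hn1
    linarith

/-- The values at `θ` of the integer polynomials with coefficients bounded by `B` and with no term
of degree less than `N` come arbitrarily close to every real number: add polynomials supported on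
disjoint sets of exponents, each of which contributes between `η / θ` and `η`. -/
theorem exists_polynomial_abs_sub_aeval_le {θ : ℝ} (hθ : Transcendental ℚ θ) (h2 : 2 ≤ θ) {B : ℕ}
    (hB : θ < B + 1) {η : ℝ} (hη : 0 < η) (N : ℕ) (t : ℝ) :
    ∃ p : ℤ[X], (∀ j, |p.coeff j| ≤ B) ∧ (∀ j < N, p.coeff j = 0) ∧ |t - aeval θ p| ≤ η := by
  have hθ0 : 0 < θ := by linarith
  wlog ht : 0 ≤ t generalizing t
  · obtain ⟨p, hp, hp0, hpt⟩ := this (-t) (by linarith)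
    refine ⟨-p, fun j => by simpa using hp j, fun j hj => by simpa using hp0 j hj, ?_⟩
    rw [← abs_neg, map_neg]
    convert hpt using 2
    ring
  have key : ∀ K : ℕ, ∃ p : ℤ[X], (∀ j, |p.coeff j| ≤ B) ∧ (∀ j < N, p.coeff j = 0) ∧
      (|t - aeval θ p| ≤ η ∨ (K * (η / θ) ≤ aeval θ p ∧ aeval θ p ≤ t)) := by
    intro K
    induction K with
    | zero => exact ⟨0, by simp, by simp, Or.inr (by simpa using ht)⟩
    | succ K ih =>
      obtain ⟨p, hp, hp0, h | ⟨h1, h3⟩⟩ := ih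
      · exact ⟨p, hp, hp0, Or.inl h⟩
      by_cases hc : |t - aeval θ p| ≤ η
      · exact ⟨p, hp, hp0, Or.inl hc⟩
      rw [abs_of_nonneg (by linarith), not_le] at hc
      obtain ⟨q, hq, hq0, hq1, hq2⟩ :=
        exists_polynomial_aeval_mem_Ioc hθ h2 hB hη (N + p.natDegree + 1)
      refine ⟨p + q, fun j => ?_, fun j hj => ?_, Or.inr ⟨?_, ?_⟩⟩
      · rw [coeff_add]
        by_cases hj : j < N + p.natDegree + 1
        · rw [hq0 j hj, add_zero]
          exact hp j
        · rw [coeff_eq_zero_of_natDegree_lt (by omega : p.natDegree < j), zero_add]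
          exact hq j
      · rw [coeff_add, hp0 j hj, hq0 j (by omega), add_zero]
      · rw [map_add]
        push_cast
        linarith
      · rw [map_add]
        linarith
  obtain ⟨K, hK⟩ := exists_nat_gt (t / (η / θ))
  rw [div_lt_iff₀ (by positivity)] at hK
  obtain ⟨p, hp, hp0, h | ⟨h1, h3⟩⟩ := key K
  · exact ⟨p, hp, hp0, h⟩
  · linarith

end Digits

/-! ### Recurrence of subset sums in precompact groups -/

/-- The sums of finitely many distinct powers `θ ^ j` with `j ≥ N`. -/
def tailSums (θ : ℝ) (N : ℕ) : Set ℝ :=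
  {x | ∃ A : Finset ℕ, (∀ j ∈ A, N ≤ j) ∧ x = ∑ j ∈ A, θ ^ j}

theorem tailSums_anti (θ : ℝ) {M N : ℕ} (h : M ≤ N) : tailSums θ N ⊆ tailSums θ M := by
  rintro x ⟨A, hA, rfl⟩
  exact ⟨A, fun j hj => h.trans (hA j hj), rfl⟩

theorem tailSums_zero_subset (θ : ℝ) : tailSums θ 0 ⊆ zeroOneSums θ := by
  classical
  rintro x ⟨A, -, rfl⟩
  refine ⟨A.sup id, fun j => if j ∈ A then 1 else 0, fun j => ?_, ?_⟩
  · by_cases h : j ∈ A <;> simp [h]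
  · simp only [ite_mul, one_mul, zero_mul, ← Finset.sum_filter]
    congr 1
    ext j
    simp only [Finset.mem_filter, Finset.mem_range, Nat.lt_succ_iff]
    exact ⟨fun h => ⟨Finset.le_sup (f := id) h, h⟩, fun h => h.2⟩

/-- The value at `θ` of a polynomial with coefficients bounded by `B` is a difference of two sums
of `B` elements of `tailSums θ N`. -/
theorem exists_multiset_aeval_eq {θ : ℝ} {B N : ℕ} {p : Polynomial ℤ}
    (hp : ∀ j, |p.coeff j| ≤ B) (hp0 : ∀ j < N, p.coeff j = 0) :
    ∃ a b : Multiset ℝ, (∀ s ∈ a, s ∈ tailSums θ N) ∧ (∀ s ∈ b, s ∈ tailSums θ N) ∧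
      a.card = B ∧ b.card = B ∧ Polynomial.aeval θ p = a.sum - b.sum := by
  have key : ∀ c : ℕ → ℕ, (∀ j, c j ≤ B) → ∃ a : Multiset ℝ, (∀ s ∈ a, s ∈ tailSums θ N) ∧
      a.card = B ∧ a.sum = ∑ j ∈ p.support, (c j : ℝ) * θ ^ j := by
    intro c hc
    refine ⟨(Multiset.range B).map fun i => ∑ j ∈ p.support.filter (i < c ·), θ ^ j, ?_, by simp, ?_⟩
    · simp only [Multiset.mem_map]
      rintro _ ⟨i, -, rfl⟩
      refine ⟨_, fun j hj => ?_, rfl⟩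
      by_contra h
      simp [hp0 j (by omega)] at hj
    · change ∑ i ∈ Finset.range B, ∑ j ∈ p.support.filter (i < c ·), θ ^ j = _
      simp only [Finset.sum_filter]
      rw [Finset.sum_comm]
      refine Finset.sum_congr rfl fun j _ => ?_
      rw [← Finset.sum_filter, Finset.sum_const, nsmul_eq_mul]
      congr 2
      rw [show (Finset.range B).filter (· < c j) = Finset.range (c j) from ?_, Finset.card_range]
      ext i
      simp only [Finset.mem_filter, Finset.mem_range]
      exact ⟨fun h => h.2, fun h => ⟨h.trans_le (hc j), h⟩⟩
  obtain ⟨a, ha, hac, has⟩ := key (fun j => (p.coeff j).toNat) fun j => by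
    have := abs_le.1 (hp j); omega
  obtain ⟨b, hb, hbc, hbs⟩ := key (fun j => (-p.coeff j).toNat) fun j => by
    have := abs_le.1 (hp j); omega
  refine ⟨a, b, ha, hb, hac, hbc, ?_⟩
  rw [has, hbs, Polynomial.aeval_eq_sum_range, ← Finset.sum_sub_distrib,
    ← Polynomial.sum_over_range' p (f := fun j z => z • θ ^ j) (by simp) _ (Nat.lt_succ_self _),
    Polynomial.sum_def]
  refine Finset.sum_congr rfl fun j _ => ?_
  rw [← sub_mul, zsmul_eq_mul]
  congr 1
  exact_mod_cast (Int.toNat_sub_toNat_neg (p.coeff j)).symm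

/-- A translation invariant notion of closeness to zero on the real line which is weaker than the
usual one and for which the line is precompact: `Near ε t` says that `t` is within `ε` of zero. -/
structure IsPrecompactGauge (Near : ℝ → ℝ → Prop) : Prop where
  add : ∀ {ε δ s t}, Near ε s → Near δ t → Near (ε + δ) (s + t)
  neg : ∀ {ε t}, Near ε t → Near ε (-t)
  of_abs_le : ∀ {ε t}, |t| ≤ ε → Near ε t
  exists_finset : ∀ {ε}, 0 < ε → ∃ F : Finset ℝ, ∀ t, ∃ f ∈ F, Near ε (t - f)

namespace IsPrecompactGauge

variable {Near : ℝ → ℝ → Prop}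

theorem zero (h : IsPrecompactGauge Near) : Near 0 0 := h.of_abs_le (by simp)

theorem mono (h : IsPrecompactGauge Near) {ε δ t : ℝ} (hεδ : ε ≤ δ) (ht : Near ε t) :
    Near δ t := by
  have h0 : Near (δ - ε) 0 := h.of_abs_le (by simpa using hεδ)
  simpa using h.add ht h0

/-- The parts of a finite net that are visited by `tailSums θ N` decrease with `N`, so they are
eventually constant: every sum with large exponents is close to sums with arbitrarily large
exponents. -/
theorem exists_tailSums_recurrent (h : IsPrecompactGauge Near) (θ : ℝ) {ε : ℝ} (hε : 0 < ε) :
    ∃ N, ∀ s ∈ tailSums θ N, ∀ N', ∃ s' ∈ tailSums θ N', Near ε (s - s') := by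
  obtain ⟨F, hF⟩ := h.exists_finset (half_pos hε)
  have hstab : ∀ f : ℝ, ∃ n, (∃ s ∈ tailSums θ n, Near (ε / 2) (s - f)) →
      ∀ N', ∃ s ∈ tailSums θ N', Near (ε / 2) (s - f) := by
    intro f
    by_cases hf : ∀ N', ∃ s ∈ tailSums θ N', Near (ε / 2) (s - f)
    · exact ⟨0, fun _ => hf⟩
    · obtain ⟨n, hn⟩ := not_forall.1 hf
      exact ⟨n, fun h' => absurd h' hn⟩
  choose n hn using hstab
  refine ⟨F.sup n, fun s hs N' => ?_⟩
  obtain ⟨f, hfF, hsf⟩ := hF s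
  obtain ⟨s', hs', hsf'⟩ := hn f ⟨s, tailSums_anti θ (Finset.le_sup hfF) hs, hsf⟩ N'
  refine ⟨s', hs', ?_⟩
  simpa using h.add hsf (h.neg hsf')

/-- Under recurrence the summands can be moved to disjoint sets of exponents, so that the tail sums
are approximately closed under addition. -/
theorem exists_tailSums_near_sum (h : IsPrecompactGauge Near) {θ ε : ℝ} {N : ℕ}
    (hN : ∀ s ∈ tailSums θ N, ∀ N', ∃ s' ∈ tailSums θ N', Near ε (s - s')) (a : Multiset ℝ)
    (ha : ∀ s ∈ a, s ∈ tailSums θ N) :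
    ∃ x ∈ tailSums θ N, Near (a.card * ε) (a.sum - x) := by
  induction a using Multiset.induction_on with
  | empty => exact ⟨0, ⟨∅, by simp, by simp⟩, by simpa using h.zero⟩
  | cons s a ih =>
    obtain ⟨_, ⟨A, hA, rfl⟩, hx⟩ := ih fun s hs => ha s (Multiset.mem_cons_of_mem hs)
    obtain ⟨_, ⟨A', hA', rfl⟩, hx'⟩ :=
      hN s (ha s (Multiset.mem_cons_self s a)) (N + A.sup id + 1)
    have hdisj : Disjoint A' A := by
      rw [Finset.disjoint_left]
      intro j hj hj'
      have h1 := hA' j hj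
      have h2 : j ≤ A.sup id := Finset.le_sup (f := id) hj'
      omega
    refine ⟨_, ⟨A'.disjUnion A hdisj, fun j hj => ?_, rfl⟩, ?_⟩
    · rcases Finset.mem_disjUnion.1 hj with hj | hj
      · have := hA' j hj
        omega
      · exact hA j hj
    · rw [Finset.sum_disjUnion, Multiset.card_cons, Multiset.sum_cons]
      convert h.add hx' hx using 1
      · push_cast
        ring
      · ring

/-- Some multiple of each real number is close to zero, with a bound on the multiplier that depends
only on the precision. -/
theorem exists_nsmul_near_zero (h : IsPrecompactGauge Near) {ε : ℝ} (hε : 0 < ε) :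
    ∃ k : ℕ, ∀ t : ℝ, ∃ l : ℕ, 0 < l ∧ l ≤ k ∧ Near ε (l * t) := by
  obtain ⟨F, hF⟩ := h.exists_finset (half_pos hε)
  refine ⟨F.card, fun t => ?_⟩
  choose f hfF hf using hF
  obtain ⟨i, hi, j, hj, hij, hfij⟩ := Finset.exists_ne_map_eq_of_card_lt_of_maps_to
    (s := Finset.range (F.card + 1)) (t := F) (f := fun i : ℕ => f (i * t)) (by simp)
    (fun i _ => hfF _)
  wlog hlt : i < j generalizing i j
  · exact this j hj i hi hij.symm hfij.symm (by omega)
  rw [Finset.mem_range] at hi hj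
  refine ⟨j - i, by omega, by omega, ?_⟩
  have := h.add (hf (j * t)) (h.neg (hf (i * t)))
  rw [← hfij, add_halves] at this
  convert this using 1
  rw [Nat.cast_sub hlt.le]
  ring

/-- The tail sums are approximately closed under subtraction as well: `a - b` is close to
`a + (l - 1) * b` if `l * b` is close to zero. -/
theorem exists_tailSums_near_sub (h : IsPrecompactGauge Near) (θ : ℝ) {ε : ℝ} (hε : 0 < ε)
    (B : ℕ) :
    ∃ N, ∀ a b : Multiset ℝ, (∀ s ∈ a, s ∈ tailSums θ N) → (∀ s ∈ b, s ∈ tailSums θ N) →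
      a.card = B → b.card = B → ∃ x ∈ tailSums θ N, Near ε (a.sum - b.sum - x) := by
  obtain ⟨k, hk⟩ := h.exists_nsmul_near_zero (half_pos hε)
  obtain ⟨N, hN⟩ := h.exists_tailSums_recurrent θ
    (show 0 < ε / 2 / ((k * B : ℕ) + 1 : ℝ) by positivity)
  refine ⟨N, fun a b ha hb hac hbc => ?_⟩
  obtain ⟨l, hl0, hlk, hl⟩ := hk b.sum
  obtain ⟨x, hx, hax⟩ := h.exists_tailSums_near_sum hN (a + (l - 1) • b) (by
    intro s hs
    rcases Multiset.mem_add.1 hs with hs | hs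
    · exact ha s hs
    · exact hb s (Multiset.mem_nsmul.1 hs).2)
  have hcard : (a + (l - 1) • b).card ≤ k * B := by
    rw [Multiset.card_add, Multiset.card_nsmul, hac, hbc]
    calc B + (l - 1) * B = (1 + (l - 1)) * B := by ring
      _ ≤ k * B := Nat.mul_le_mul_right _ (by omega)
  have hle : (((a + (l - 1) • b).card : ℕ) : ℝ) * (ε / 2 / ((k * B : ℕ) + 1 : ℝ)) ≤ ε / 2 := by
    rw [mul_div_assoc', div_le_iff₀ (by positivity), mul_comm]
    have : (((a + (l - 1) • b).card : ℕ) : ℝ) ≤ (k * B : ℕ) := by exact_mod_cast hcard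
    gcongr
    linarith
  refine ⟨x, hx, ?_⟩
  convert h.mono (show _ ≤ ε by linarith) (h.add hax (h.neg hl)) using 1
  rw [Multiset.sum_add, Multiset.sum_nsmul, nsmul_eq_mul, Nat.cast_sub hl0]
  push_cast
  ring

/-- The sums `∑ c j * θ ^ j` with `c j ∈ {0, 1}` are dense for every precompact gauge. -/
theorem exists_zeroOneSums_near (h : IsPrecompactGauge Near) {θ : ℝ} (hθ : Transcendental ℚ θ)
    (h2 : 2 ≤ θ) (t : ℝ) {ε : ℝ} (hε : 0 < ε) : ∃ x ∈ zeroOneSums θ, Near ε (t - x) := by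
  obtain ⟨B, hB⟩ := exists_nat_gt θ
  obtain ⟨N, hN⟩ := h.exists_tailSums_near_sub θ (half_pos hε) B
  obtain ⟨p, hp, hp0, hpt⟩ := exists_polynomial_abs_sub_aeval_le hθ h2
    (show θ < (B : ℝ) + 1 by linarith) (half_pos hε) N t
  obtain ⟨a, b, ha, hb, hac, hbc, hab⟩ := exists_multiset_aeval_eq (θ := θ) hp hp0
  obtain ⟨x, hx, hnear⟩ := hN a b ha hb hac hbc
  refine ⟨x, tailSums_zero_subset θ (tailSums_anti θ (Nat.zero_le N) hx), ?_⟩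
  rw [← hab] at hnear
  have := h.add (h.of_abs_le hpt) hnear
  rw [add_halves] at this
  convert this using 1
  ring

end IsPrecompactGauge

/-! ### Density for Bohr almost periodic functions -/

/-- `N` is dense in `ℤ` for Bohr almost periodic functions, that is, dense for the topology induced
by the Bohr compactification. -/
def IsBohrDense (N : Set ℤ) : Prop :=
  ∀ u : ℤ → ℂ, IsBohrAlmostPeriodic u → ∀ (n : ℤ) (ε : ℝ), 0 < ε → ∃ k ∈ N, ‖u n - u k‖ ≤ ε

theorem norm_sub_le_of_mem_almostPeriods {u : ℤ → ℂ} {ε : ℝ} (hε : 0 < ε) {p : ℤ}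
    (hp : p ∈ almostPeriods u ε) (m : ℤ) : ‖u m - u (m - p)‖ ≤ ε := by
  have h1 : ‖u m - u (m - p)‖ₑ < ENNReal.ofReal ε :=
    (le_iSup (fun t => ‖u t - u (t - p)‖ₑ) m).trans_lt hp
  rw [← ofReal_norm] at h1
  exact ((ENNReal.ofReal_lt_ofReal_iff hε).1 h1).le

theorem isRelativelyDense_int_iff {P : Set ℤ} :
    IsRelativelyDense P ↔ ∃ F : Finset ℤ, ∀ n, ∃ f ∈ F, n - f ∈ P := by
  constructor
  · rintro ⟨K, hK, hPK⟩
    have hK' := isCompact_iff_finite.1 hK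
    refine ⟨hK'.toFinset, fun n => ?_⟩
    obtain ⟨p, hp, f, hf, rfl⟩ := Set.mem_add.1 (hPK ▸ Set.mem_univ n)
    exact ⟨f, hK'.mem_toFinset.2 hf, by simpa using hp⟩
  · rintro ⟨F, hF⟩
    refine ⟨F, F.finite_toSet.isCompact, Set.eq_univ_of_forall fun n => ?_⟩
    obtain ⟨f, hf, hn⟩ := hF n
    exact Set.mem_add.2 ⟨n - f, hn, f, hf, by simp⟩

/-- The almost periods of a Bohr almost periodic function on `ℤ`, thickened to a subset of the real
line. -/
theorem isPrecompactGauge_of_isBohrAlmostPeriodic {u : ℤ → ℂ} (hu : IsBohrAlmostPeriodic u) :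
    IsPrecompactGauge fun ε t => ∃ n : ℤ, (∀ m, ‖u m - u (m - n)‖ ≤ ε) ∧ |t - n| ≤ ε where
  add := by
    rintro ε δ s t ⟨n, hn, hs⟩ ⟨k, hk, ht⟩
    refine ⟨n + k, fun m => ?_, ?_⟩
    · calc ‖u m - u (m - (n + k))‖ = ‖(u m - u (m - n)) + (u (m - n) - u (m - n - k))‖ := by
            rw [sub_add_sub_cancel, sub_sub]
        _ ≤ ε + δ := (norm_add_le _ _).trans (add_le_add (hn m) (hk _))
    · push_cast
      calc |s + t - (n + k)| = |(s - n) + (t - k)| := by ring_nf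
        _ ≤ ε + δ := (abs_add_le _ _).trans (add_le_add hs ht)
  neg := by
    rintro ε t ⟨n, hn, ht⟩
    refine ⟨-n, fun m => ?_, ?_⟩
    · rw [norm_sub_rev]
      simpa using hn (m - -n)
    · rw [← abs_neg]
      push_cast
      convert ht using 2
      ring
  of_abs_le := by
    intro ε t ht
    have hε : 0 ≤ ε := (abs_nonneg t).trans ht
    exact ⟨0, by simpa using hε, by simpa using ht⟩
  exists_finset := by
    intro ε hε
    obtain ⟨F, hF⟩ := isRelativelyDense_int_iff.1 (hu.2 ε hε)
    obtain ⟨q, hq⟩ := exists_nat_gt (1 / ε)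
    have hq0 : (0 : ℝ) < q := (by positivity : 0 < 1 / ε).trans hq
    -- The real net consists of the points `f + i / q` with `f` in the integer net.
    refine ⟨(F ×ˢ Finset.range q).image fun a => (a.1 : ℝ) + a.2 / q, fun t => ?_⟩
    obtain ⟨f, hf, hP⟩ := hF ⌊t⌋
    refine ⟨(f : ℝ) + (⌊Int.fract t * q⌋₊ : ℕ) / q, Finset.mem_image.2
      ⟨(f, ⌊Int.fract t * q⌋₊), Finset.mem_product.2 ⟨hf, Finset.mem_range.2 ?_⟩, rfl⟩,
      ⌊t⌋ - f, norm_sub_le_of_mem_almostPeriods hε hP, ?_⟩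
    · rw [Nat.floor_lt (mul_nonneg (Int.fract_nonneg t) hq0.le)]
      nlinarith [Int.fract_lt_one t]
    · have h1 := Nat.floor_le (mul_nonneg (Int.fract_nonneg t) hq0.le)
      have h2 := Nat.lt_floor_add_one (Int.fract t * q)
      set j := ⌊Int.fract t * q⌋₊
      have h3 : t - (f + (j : ℝ) / q) - ((⌊t⌋ - f : ℤ) : ℝ) = (Int.fract t * q - j) / q := by
        rw [← Int.self_sub_floor] at *
        field_simp
        push_cast
        ring
      rw [h3, abs_of_nonneg (div_nonneg (by linarith) hq0.le), div_le_iff₀ hq0]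
      rw [div_lt_iff₀ hε] at hq
      linarith

/-- If `n - x` is close to an almost period `m` of `u`, then `n - m` is one of the two integers next
to `x`, and `u (n - m)` is close to `u n`. -/
theorem isBohrDense_thetaSet {θ : ℝ} (hθ : Transcendental ℚ θ) (h2 : 2 ≤ θ) :
    IsBohrDense (thetaSet θ) := by
  intro u hu n ε hε
  obtain ⟨x, hx, m, hm, hxm⟩ := (isPrecompactGauge_of_isBohrAlmostPeriodic hu).exists_zeroOneSums_near
    hθ h2 n (show 0 < min ε (1 / 2) by positivity)
  refine ⟨n - m, ⟨x, hx, ?_⟩, (hm n).trans (min_le_left _ _)⟩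
  have h1 := abs_le.1 (hxm.trans (min_le_right _ _))
  rcases le_or_gt ((n - m : ℤ) : ℝ) x with h | h
  · left
    symm
    rw [Int.floor_eq_iff]
    push_cast at h ⊢
    constructor <;> linarith
  · right
    rw [← sub_eq_iff_eq_add]
    symm
    rw [Int.floor_eq_iff]
    push_cast at h ⊢
    constructor <;> linarith

/-! ### Generalized almost periodicity of complements of Bohr dense sets -/

/-- The function `δ_0 ∈ C_c(ℤ)`; convolution with it evaluates a measure at the points of `ℤ`. -/
def deltaZero : C_c(ℤ, ℂ) where
  toFun := Pi.single 0 1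
  continuous_toFun := continuous_of_discreteTopology
  hasCompactSupport' := HasCompactSupport.intro (K := {0}) isCompact_singleton
    fun n hn => Pi.single_eq_of_ne (by simpa using hn) 1

theorem deltaZero_apply (n : ℤ) : deltaZero n = if n = 0 then 1 else 0 := by
  change (Pi.single 0 1 : ℤ → ℂ) n = _
  rw [Pi.single_apply]

theorem reflectTranslate_deltaZero_apply (n t : ℤ) :
    reflectTranslate deltaZero n t = if t = n then 1 else 0 := by
  change deltaZero (n - t) = _
  rw [deltaZero_apply]
  simp only [sub_eq_zero, eq_comm]

theorem conv_deltaZero_re_intComb (Λ : Set ℤ) [DecidablePred (· ∈ Λ)] (n : ℤ) :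
    conv deltaZero (intComb Λ).re n = if n ∈ Λ then 1 else 0 := by
  have hsupp : Function.support (reflectTranslate deltaZero n) ⊆ ({n} : Finset ℤ) := by
    intro t ht
    by_contra h
    exact ht (by rw [reflectTranslate_deltaZero_apply, if_neg (by simpa using h)])
  have hstar : star (reflectTranslate deltaZero n) = reflectTranslate deltaZero n := by
    ext t
    rw [CompactlySupportedContinuousMap.star_apply, reflectTranslate_deltaZero_apply]
    split_ifs <;> simp
  have heval : (intComb Λ).eval (reflectTranslate deltaZero n) = if n ∈ Λ then 1 else 0 := by
    rw [intComb_eval Λ _ hsupp, Finset.sum_singleton, reflectTranslate_deltaZero_apply, if_pos rfl]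
  have hconj : (intComb Λ).conj.eval (reflectTranslate deltaZero n) = if n ∈ Λ then 1 else 0 := by
    change star ((intComb Λ).eval (star (reflectTranslate deltaZero n))) = _
    rw [hstar, heval]
    split_ifs <;> simp
  change (1 / 2 : ℂ) * ((intComb Λ).eval _ + (intComb Λ).conj.eval _) = _
  rw [heval, hconj]
  split_ifs <;> norm_num

theorem re_conv_deltaZero_le {μ ν : RadonMeasure ℤ} (h : (ν - μ).IsPositive) (n : ℤ) :
    (conv deltaZero μ n).re ≤ (conv deltaZero ν n).re := by
  have h1 := (h (reflectTranslate deltaZero n) fun t => by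
    rw [reflectTranslate_deltaZero_apply]
    split_ifs <;> simp).1
  have h2 : (ν - μ).eval (reflectTranslate deltaZero n) =
      conv deltaZero ν n - conv deltaZero μ n := rfl
  rw [h2, Complex.sub_re] at h1
  linarith

theorem integral_deltaZero : ∫ n, deltaZero n ∂(Measure.count : Measure ℤ) = 1 := by
  have h : ∀ n : ℤ, deltaZero n = ({0} : Set ℤ).indicator (fun _ => (1 : ℂ)) n := by
    intro n
    rw [deltaZero_apply, Set.indicator_apply]
    simp
  simp only [h]
  rw [integral_indicator (measurableSet_singleton 0)]
  simp [Measure.real]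

theorem denseRange_toBohr : DenseRange (toBohr : ℤ → BohrCompactification ℤ) := by
  rintro ⟨y, hy⟩
  refine closure_subtype.2 (closure_mono ?_ hy)
  rintro _ ⟨x, rfl⟩
  exact ⟨_, ⟨x.toAdd, rfl⟩, rfl⟩

/-- The mean is monotone in the following sense: a lower bound for the function passes to the
continuous extension, by density, and hence to its integral. -/
theorem AlmostPeriodic.FunctionHasMean.le_re {f : ℤ → ℂ} {c : ℂ} (hf : FunctionHasMean f c) {b : ℝ}
    (hb : ∀ n, b ≤ (f n).re) : b ≤ c.re := by
  obtain ⟨F, hF, rfl⟩ := hf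
  set m := Measure.haarMeasure (⊤ : TopologicalSpace.PositiveCompacts (BohrCompactification ℤ))
  have hprob : IsProbabilityMeasure m := ⟨by
    have := Measure.haarMeasure_self
      (K₀ := (⊤ : TopologicalSpace.PositiveCompacts (BohrCompactification ℤ)))
    simpa using this⟩
  have hFb : ∀ y, b ≤ (F y).re := by
    have hclosed : IsClosed {y | b ≤ (F y).re} :=
      isClosed_le continuous_const (Complex.continuous_re.comp F.continuous)
    refine fun y => denseRange_toBohr.induction_on (p := fun y => b ≤ (F y).re) y hclosed fun n => ?_
    rw [hF]
    exact hb n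
  have hint : Integrable F m :=
    F.continuous.integrable_of_hasCompactSupport (HasCompactSupport.of_compactSpace F)
  have h1 : (∫ y, F y ∂m).re = ∫ y, (F y).re ∂m := (integral_re hint).symm
  rw [h1]
  calc b = ∫ _, b ∂m := by simp
    _ ≤ ∫ y, (F y).re ∂m := integral_mono (integrable_const _) hint.re hFb

/-- Let `μ ≤ δ_Λ ≤ ν` with strongly almost periodic `μ` and `ν`. The density of `ℤ \ Λ` forces
`μ ≤ 0` everywhere, and the density of `Λ` forces `ν ≥ 1` everywhere, so that `ν - μ` has mean at
least `1`. -/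
theorem not_isGeneralizedAlmostPeriodic_compl {N : Set ℤ} (hB : IsBohrDense N)
    (h0 : HasZeroBanachDensity N) :
    ¬ IsGeneralizedAlmostPeriodic Measure.count (intComb (Set.univ \ N)) := by
  classical
  rintro ⟨-, ⟨-, -, hgap⟩, -⟩
  obtain ⟨μ, ν, hμ, hν, hμρ, hρν, c, hc, hc1⟩ := hgap 1 one_pos
  have hle : ∀ n, (conv deltaZero μ n).re ≤ 0 := by
    intro n
    refine le_of_forall_pos_le_add fun ε hε => ?_
    obtain ⟨k, hk, hnk⟩ := hB _ (hμ.2 deltaZero) n ε hε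
    have h1 := re_conv_deltaZero_le hμρ k
    rw [conv_deltaZero_re_intComb, if_neg (by simpa using hk), Complex.zero_re] at h1
    have h2 := (abs_le.1 ((Complex.abs_re_le_norm _).trans hnk)).2
    rw [Complex.sub_re] at h2
    linarith
  have hge : ∀ n, 1 ≤ (conv deltaZero ν n).re := by
    intro n
    refine le_of_forall_pos_le_add fun ε hε => ?_
    obtain ⟨F, hF⟩ := isRelativelyDense_int_iff.1 ((hν.2 deltaZero).2 ε hε)
    -- Some element `m` of the complement of `N` differs from `n` by an almost period of `ν`.
    obtain ⟨l, hl⟩ := h0.exists_forall_add_notMem F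
    obtain ⟨f, hf, hp⟩ := hF (n - l)
    have h1 := norm_sub_le_of_mem_almostPeriods hε hp n
    rw [show n - (n - l - f) = l + f by ring] at h1
    have h2 := re_conv_deltaZero_le hρν (l + f)
    rw [conv_deltaZero_re_intComb, if_pos (by simpa using hl f hf), Complex.one_re] at h2
    have h3 := (abs_le.1 ((Complex.abs_re_le_norm _).trans h1)).1
    rw [Complex.sub_re] at h3
    linarith
  have hmean := (hc deltaZero).le_re (b := 1) fun n => by
    have h2 : conv deltaZero (ν - μ) n = conv deltaZero ν n - conv deltaZero μ n := rfl
    rw [h2, Complex.sub_re]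
    linarith [hle n, hge n]
  rw [integral_deltaZero, one_mul, Complex.ofReal_re] at hmean
  linarith

/-! ### Model sets and Bohr dense sets -/

/-- A continuous function on a compact group is Bohr almost periodic along a dense cyclic
subgroup. -/
theorem isBohrAlmostPeriodic_zsmul {H : Type*} [AddCommGroup H] [TopologicalSpace H]
    [IsTopologicalAddGroup H] [CompactSpace H] {g : H → ℂ} (hg : Continuous g) {h : H}
    (hh : DenseRange fun n : ℤ => n • h) : IsBohrAlmostPeriodic fun n : ℤ => g (n • h) := by
  refine ⟨⟨?_, fun ε hε => ⟨{0}, by simp, ?_⟩⟩, fun ε hε => isRelativelyDense_int_iff.2 ?_⟩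
  · obtain ⟨C, hC⟩ := isCompact_univ.exists_bound_of_continuousOn hg.continuousOn
    exact ⟨C, fun n => hC _ trivial⟩
  · rintro u rfl x
    simpa using hε
  · obtain ⟨U, V, -, hV, hU, hV0, hUV⟩ := generalized_tube_lemma (isCompact_univ (X := H))
      (isCompact_singleton (x := (0 : H))) (n := {p | ‖g p.1 - g (p.1 - p.2)‖ < ε / 2})
      (isOpen_lt (by fun_prop) continuous_const) (by
        rintro ⟨x, y⟩ ⟨-, rfl⟩
        simpa using hε)
    have hcover : (Set.univ : Set H) ⊆ ⋃ f : ℤ, {z | z - f • h ∈ V} := by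
      intro z _
      obtain ⟨f, hf⟩ := hh.exists_mem_open (s := {y | z - y ∈ V})
        (hV.preimage (continuous_const.sub continuous_id)) ⟨z, by simpa using hV0⟩
      exact Set.mem_iUnion.2 ⟨f, hf⟩
    obtain ⟨F, hF⟩ := isCompact_univ.elim_finite_subcover _
      (fun f : ℤ => hV.preimage (continuous_id.sub continuous_const)) hcover
    refine ⟨F, fun n => ?_⟩
    obtain ⟨f, hf, hn⟩ := Set.mem_iUnion₂.1 (hF (Set.mem_univ (n • h)))
    refine ⟨f, hf, lt_of_le_of_lt (b := ENNReal.ofReal (ε / 2)) (iSup_le fun t => ?_)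
      ((ENNReal.ofReal_lt_ofReal_iff hε).2 (by linarith))⟩
    rw [← ofReal_norm]
    refine ENNReal.ofReal_le_ofReal (le_of_lt ?_)
    have hmem : ((t • h, n • h - f • h) : H × H) ∈ U ×ˢ V := ⟨hU trivial, hn⟩
    have := hUV hmem
    simpa only [Set.mem_ofPred_eq, sub_smul] using this

/-- If the lattice consists of pairs `(n, n • h)`, then the internal space is compact, being
the image of the quotient of `ℤ × H` by the lattice under `(n, y) ↦ y - n • h`. -/
theorem AlmostPeriodic.CutAndProjectScheme.compactSpace_of_forall_eq_zsmul {H : Type*}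
    [AddCommGroup H] [TopologicalSpace H] [IsTopologicalAddGroup H] (S : CutAndProjectScheme ℤ H) {h : H}
    (hS : ∀ p ∈ S.lattice, p.2 = p.1 • h) : CompactSpace H := by
  have := S.cocompact
  let φ : ℤ × H →+ H :=
    { toFun := fun p => p.2 - p.1 • h
      map_zero' := by simp
      map_add' := fun p q => by
        simp only [Prod.fst_add, Prod.snd_add, add_smul]
        abel }
  have hφ : Continuous φ := by
    change Continuous fun p : ℤ × H => p.2 - p.1 • h
    have : Continuous fun n : ℤ => n • h := continuous_of_discreteTopology
    exact continuous_snd.sub (this.comp continuous_fst)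
  let ψ : (ℤ × H) ⧸ S.lattice →+ H := QuotientAddGroup.lift S.lattice φ fun p hp => by
    change p.2 - p.1 • h = 0
    rw [hS p hp, sub_self]
  have hψ : Continuous ψ := hφ.quotient_lift _
  refine ⟨?_⟩
  rw [← Set.range_eq_univ.2 (show Function.Surjective ψ from fun y => ⟨((0, y) : ℤ × H), ?_⟩)]
  · exact isCompact_range hψ
  · change y - (0 : ℤ) • h = y
    simp

/-- The complement `Λ` of a Bohr dense set of zero density cannot be described by a window with
non-empty interior. Since `Λ` contains two consecutive integers, the lattice is generated by some
`(1, h)`, and `H` is compact with dense subgroup `ℤ • h`. Then the multiples of `h` by the elements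
of the Bohr dense set are dense in `H`, while none of them lies in the window. -/
theorem not_isRegularModelSet_compl {N : Set ℤ} (hB : IsBohrDense N)
    (h0 : HasZeroBanachDensity N) : ¬ IsRegularModelSet.{0, u} (Set.univ \ N) := by
  rintro ⟨H, _, _, _, _, _, _, _, S, W, hW, -, -, hΛ⟩
  obtain ⟨n, hn⟩ := h0.exists_forall_add_notMem {0, 1}
  have hmem : ∀ m, m ∉ N → ∃ y ∈ W, (m, y) ∈ S.lattice := fun m hm => by
    have : m ∈ S.cutAndProjectSet W := hΛ ▸ ⟨trivial, hm⟩
    exact this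
  obtain ⟨y, -, hy⟩ := hmem n (by simpa using hn 0 (by simp))
  obtain ⟨z, -, hz⟩ := hmem (n + 1) (hn 1 (by simp))
  obtain ⟨h, hh⟩ : ∃ h : H, ((1, h) : ℤ × H) ∈ S.lattice := by
    refine ⟨z - y, ?_⟩
    simpa using S.lattice.sub_mem hz hy
  have hmul : ∀ n : ℤ, ((n, n • h) : ℤ × H) ∈ S.lattice := fun n => by
    simpa using S.lattice.zsmul_mem hh n
  have hS : ∀ p ∈ S.lattice, p.2 = p.1 • h := by
    intro p hp
    have := @S.injective_fst ⟨p, hp⟩ ⟨_, hmul p.1⟩ rfl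
    exact congrArg (fun q : S.lattice => q.1.2) this
  have := S.compactSpace_of_forall_eq_zsmul hS
  have hdense : DenseRange fun n : ℤ => n • h := by
    refine S.dense_snd.mono ?_
    rintro _ ⟨p, rfl⟩
    exact ⟨p.1.1, (hS p.1 p.2).symm⟩
  obtain ⟨m, hm⟩ := hdense.exists_mem_open isOpen_interior hW
  obtain ⟨g, hg0, hg1, -⟩ := exists_continuous_zero_one_of_isClosed
    (isOpen_interior (s := W)).isClosed_compl (isClosed_singleton (x := m • h))
    (Set.disjoint_singleton_right.2 (by simpa using hm))
  obtain ⟨k, hk, hmk⟩ := hB _ (isBohrAlmostPeriodic_zsmul (g := fun x => (g x : ℂ))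
    (Complex.continuous_ofReal.comp g.continuous) hdense) m (1 / 2) (by norm_num)
  have hkW : k • h ∉ interior W := by
    intro hkW
    have : k ∈ Set.univ \ N := hΛ ▸ ⟨k • h, interior_subset hkW, hmul k⟩
    exact this.2 hk
  have h1 : g (m • h) = 1 := hg1 rfl
  have h2 : g (k • h) = 0 := hg0 hkW
  simp only [h1, h2] at hmk
  norm_num at hmk

/-! ### The example -/

theorem exists_transcendental_three_lt : ∃ θ : ℝ, Transcendental ℚ θ ∧ 3 < θ := by
  by_contra! hcon
  have hcount : (Set.Ioi (3 : ℝ)).Countable := (Algebraic.countable ℚ ℝ).mono fun x hx => by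
    by_contra h
    exact not_lt.2 (hcon x h) hx
  have := Cardinal.le_aleph0_iff_set_countable.2 hcount
  rw [Cardinal.mk_Ioi_real] at this
  exact not_lt.2 this Cardinal.aleph0_lt_continuum

theorem complement_thetaSet_properties {θ : ℝ} (hθ : Transcendental ℚ θ) (h3 : 3 < θ) :
    IsRelativelyDense (Set.univ \ thetaSet θ) ∧
      (∀ A : ℕ → Set ℤ, IsVanHoveSequence Measure.count A →
        uniformUpperDensity Measure.count A
          (intComb (Set.univ \ thetaSet θ) - intComb Set.univ) = 0) ∧
      ¬ IsRegularModelSet.{0, u} (Set.univ \ thetaSet θ) ∧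
      IsWeylAlmostPeriodic Measure.count (intComb (Set.univ \ thetaSet θ)) ∧
      ¬ IsGeneralizedAlmostPeriodic Measure.count (intComb (Set.univ \ thetaSet θ)) :=
  have h0 := hasZeroBanachDensity_thetaSet h3
  have hB := isBohrDense_thetaSet hθ (by linarith)
  ⟨h0.isRelativelyDense_compl, fun _ hA => h0.uniformUpperDensity_eq_zero hA,
    not_isRegularModelSet_compl hB h0, h0.isWeylAlmostPeriodic,
    not_isGeneralizedAlmostPeriodic_compl hB h0⟩

theorem theorem5p6 :
    (∃ Λ : Set ℤ,
      IsRelativelyDense Λ ∧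
      (∀ A : ℕ → Set ℤ, IsVanHoveSequence Measure.count A →
        uniformUpperDensity Measure.count A (intComb Λ - intComb Set.univ) = 0) ∧
      ¬ IsRegularModelSet.{0, u} Λ ∧
      IsWeylAlmostPeriodic Measure.count (intComb Λ) ∧
      ¬ IsGeneralizedAlmostPeriodic Measure.count (intComb Λ)) ∧
    ∀ θ : ℝ, Transcendental ℚ θ → 3 < θ →
      IsRelativelyDense (Set.univ \ thetaSet θ) ∧
      (∀ A : ℕ → Set ℤ, IsVanHoveSequence Measure.count A →
        uniformUpperDensity Measure.count A
          (intComb (Set.univ \ thetaSet θ) - intComb Set.univ) = 0) ∧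
      ¬ IsRegularModelSet.{0, u} (Set.univ \ thetaSet θ) ∧
      IsWeylAlmostPeriodic Measure.count (intComb (Set.univ \ thetaSet θ)) ∧
      ¬ IsGeneralizedAlmostPeriodic Measure.count
        (intComb (Set.univ \ thetaSet θ)) := by
  obtain ⟨θ, hθ, h3⟩ := exists_transcendental_three_lt
  exact ⟨⟨_, complement_thetaSet_properties hθ h3⟩,
    fun θ hθ h3 => complement_thetaSet_properties hθ h3⟩
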